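/- Let $(\mathcal K,[\cdot,\cdot])$ be a Krein space, let $N\in B(\mathcal K)$ be normal, i.e. $NN^+=N^+N$ for the Krein space adjoint $N^+$, and put $A=\frac{N+N^+}{2}$, $B=\frac{N-N^+}{2i}$. Let $p_1,\dots,p_m\in\mathbb R[x,y]\setminus\{0\}$ be real definitizing polynomials for $N$, i.e. $[p_j(A,B)v,v]\ge 0$ for all $v\in\mathcal K$. Let $I$ be the ideal of $\mathbb C[x,y]$ generated by $p_1,\dots,p_m$ and $$V_{\mathbb R}(I)=\{z\in\mathbb C: p_k(\operatorname{Re}z,\operatorname{Im}z)=0 \text{ for } k=1,\dots,m\}.$$ For a polynomial $r\in\mathbb C[x,y]$ and $z\in\mathbb C$ write $r(z)=r(\operatorname{Re}z,\operatorname{Im}z)$, and let $r^\#(x,y)=\overline{r(\bar x,\bar y)}$. Let $\mathcal H_k$ be the Hilbert space completion of $\mathcal K/\ker p_k(A,B)$ with respect to $[p_k(A,B)\,\cdot,\cdot]$, and let the injective bounded operator $T_k:\mathcal H_k\to\mathcal K$ be the adjoint of the factor mapping $\mathcal K\to\mathcal H_k$, so that $T_kT_k^+=p_k(A,B)$. Let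 $\mathcal H$ and $T:\mathcal H\to\mathcal K$ be obtained in the same way from $\sum_{k=1}^m p_k(A,B)$. For $C\in B(\mathcal K)$ put $\Theta_k(C)=T_k^{-1}CT_k\in B(\mathcal H_k)$ if $C$ commutes with $T_kT_k^+$, and $\Theta(C)=T^{-1}CT\in B(\mathcal H)$ if $C$ commutes with $TT^+$; for $D\in B(\mathcal H_k)$ put $\Xi_k(D)=T_kDT_k^+$. The operators $\Theta_k(N)$ and $\Theta(N)$ are normal and $\sigma(\Theta_k(N))\subseteq\sigma(\Theta(N))$; let $E_k$ be the spectral measure of $\Theta_k(N)$. Let $\mathfrak B(\sigma(\Theta(N)))$ be the $*$-algebra of bounded Borel measurable functions $\sigma(\Theta(N))\to\mathbb C$, and equip $\mathcal R=\mathbb C[x,y]\times\mathfrak B(\sigma(\Theta(N)))^m$ with the componentwise vector space structure, the multiplication $$(r,f_1,\dots,f_m)\cdot(s,g_1,\dots,g_m)=\Big(rs,\ rg_1+sf_1+f_1\sum_{k=1}^m g_kp_k,\ \dots,\ rg_m+sf_m+f_m\sum_{k=1}^m g_kp_k\Big)$$ and the operation $(r,f_1,\dots,f_m)^\#=(r^\#,\overline{f_1},\dots,\overline{f_m})$.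 Let $\mathcal N$ be the set of all $(r,f_1,\dots,f_m)\in\mathcal R$ such that $r+\sum_{k=1}^m f_kp_k=0$ on $\sigma(\Theta(N))\setminus V_{\mathbb R}(I)$ and such that there are $u_1,\dots,u_m\in\mathbb C[x,y]$ with $r=\sum_{k=1}^m u_kp_k$ and $(f_j+u_j)(z)=0$ for all $j=1,\dots,m$ and $z\in V_{\mathbb R}(I)\cap\sigma(\Theta(N))$. Then $\mathcal N$ is a two-sided ideal of $\mathcal R$, and $\mathcal R/\mathcal N$ is a commutative unital $*$-algebra with the involution induced by ${\cdot}^\#$. Put $$\Psi(r,f_1,\dots,f_m)=r(A,B)+\sum_{k=1}^m\Xi_k\Big(\int_{\sigma(\Theta_k(N))}f_k\,dE_k\Big).$$ **Theorem.** The map $(r,f_1,\dots,f_m)+\mathcal N\mapsto\Psi(r,f_1,\dots,f_m)$ is a well-defined (unital) $*$-homomorphism from $\mathcal R/\mathcal N$ into the bicommutant $\{N,N^+\}''\subseteq B(\mathcal K)$, where the involution of $B(\mathcal K)$ is the Krein space adjoint. -/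

import Mathlib

open scoped InnerProductSpace ComplexOrder ComplexConjugate CompactlySupported
open MeasureTheory

noncomputable section
namespace KreinCalculus

/-- `ℂ[x, y]`. -/
abbrev Poly : Type := MvPolynomial (Fin 2) ℂ

/-- `p ∈ ℝ[x, y]` as an element of `ℂ[x, y]`. -/
def complexify (p : MvPolynomial (Fin 2) ℝ) : Poly :=
  MvPolynomial.map Complex.ofRealHom p

/-! ## Krein spaces -/

/-- A Krein space, given by a fundamental symmetry: a complex Hilbert space `K` with an operator
`J = J* = J⁻¹`; the indefinite inner product is `[x, y] = (J x, y)`. The fundamental decomposition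
is `K = ker (J - 1) [+] ker (J + 1)`. -/
class KreinSpace (K : Type*) [NormedAddCommGroup K] [InnerProductSpace ℂ K] [CompleteSpace K] where
  J : K →L[ℂ] K
  adjoint_J : ContinuousLinearMap.adjoint J = J
  J_comp_J : J ∘L J = ContinuousLinearMap.id ℂ K

section Krein
variable {K : Type*} [NormedAddCommGroup K] [InnerProductSpace ℂ K] [CompleteSpace K] [KreinSpace K]
variable {H : Type*} [NormedAddCommGroup H] [InnerProductSpace ℂ H] [CompleteSpace H]

/-- The indefinite inner product `[x, y]` (Mathlib's convention: linear in `y`). -/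
def form (x y : K) : ℂ := ⟪KreinSpace.J x, y⟫_ℂ

/-- The Krein space adjoint `C⁺` of `C ∈ B(K)`: `[C x, y] = [x, C⁺ y]`, see `form_kadj`. -/
def kadj (C : K →L[ℂ] K) : K →L[ℂ] K :=
  KreinSpace.J ∘L ContinuousLinearMap.adjoint C ∘L KreinSpace.J

/-- The Krein space adjoint `T⁺ : K → H` of `T : H → K`, `H` a Hilbert space:
`[T h, y] = (h, T⁺ y)`, see `form_hkadj`. -/
def hkadj (T : H →L[ℂ] K) : K →L[ℂ] H := ContinuousLinearMap.adjoint T ∘L KreinSpace.J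

theorem J_J (x : K) : (KreinSpace.J (KreinSpace.J x) : K) = x :=
  DFunLike.congr_fun (KreinSpace.J_comp_J (K := K)) x

theorem inner_J_left (x y : K) : ⟪(KreinSpace.J x : K), y⟫_ℂ = ⟪x, KreinSpace.J y⟫_ℂ := by
  rw [← ContinuousLinearMap.adjoint_inner_right, KreinSpace.adjoint_J]

theorem form_conj (x y : K) : conj (form y x) = form x y := by
  simp only [form, inner_conj_symm, inner_J_left]

theorem form_kadj (C : K →L[ℂ] K) (x y : K) : form (C x) y = form x (kadj C y) := by
  simp only [form, kadj, inner_J_left, ContinuousLinearMap.comp_apply, J_J,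
    ContinuousLinearMap.adjoint_inner_right]

theorem form_hkadj (T : H →L[ℂ] K) (h : H) (y : K) : form (T h) y = ⟪h, hkadj T y⟫_ℂ := by
  simp only [form, hkadj, inner_J_left, ContinuousLinearMap.comp_apply,
    ContinuousLinearMap.adjoint_inner_right]

/-- `N` is normal on the Krein space: `N N⁺ = N⁺ N`. -/
def IsKreinNormal (N : K →L[ℂ] K) : Prop := N ∘L kadj N = kadj N ∘L N

/-- The real part `A = (N + N⁺) / 2`. -/
def reOp (N : K →L[ℂ] K) : K →L[ℂ] K := (1 / 2 : ℂ) • (N + kadj N)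

/-- The imaginary part `B = (N - N⁺) / (2 i)`. -/
def imOp (N : K →L[ℂ] K) : K →L[ℂ] K := (1 / (2 * Complex.I)) • (N - kadj N)

/-- The operator `r(A, B) = ∑ r_{kl} A^k B^l` for `r = ∑ r_{kl} x^k y^l` in `ℂ[x, y]`. -/
def evalOp (r : Poly) (A B : K →L[ℂ] K) : K →L[ℂ] K :=
  ∑ s ∈ r.support, r.coeff s • (A ^ (s 0) * B ^ (s 1))

/-- `p ∈ ℝ[x, y] \ {0}` is a real definitizing polynomial for `N`: `[p(A, B) v, v] ≥ 0` for all `v`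
(`0 ≤ w` for a complex `w` says that `w` is real and nonnegative). -/
def IsDefinitizing (N : K →L[ℂ] K) (p : MvPolynomial (Fin 2) ℝ) : Prop :=
  p ≠ 0 ∧ ∀ v : K, 0 ≤ form (evalOp (complexify p) (reOp N) (imOp N) v) v

/-- Operators `P ∈ B(K)` with `[P v, v] ≥ 0` for all `v`. -/
structure PosOp (K : Type*) [NormedAddCommGroup K] [InnerProductSpace ℂ K] [CompleteSpace K]
    [KreinSpace K] where
  op : K →L[ℂ] K
  nonneg : ∀ v : K, 0 ≤ form (op v) v

theorem form_add_left (x y z : K) : form (x + y) z = form x z + form y z := by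
  simp [form]
theorem form_smul_left (c : ℂ) (x y : K) : form (c • x) y = conj c * form x y := by
  simp [form, mul_comm]

theorem PosOp.symm (P : PosOp K) (x y : K) : form (P.op x) y = form x (P.op y) := by
  have h : ContinuousLinearMap.IsPositive (KreinSpace.J ∘L P.op) := by
    rw [ContinuousLinearMap.isPositive_iff_complex]
    intro v
    have := P.nonneg v
    rw [form, Complex.nonneg_iff] at this
    refine ⟨?_, this.1⟩
    apply Complex.ext <;> simp [this.2.symm]
  have := h.isSymmetric x y
  simpa [form, inner_J_left] using this

/-! ### The Hilbert space of a positive operator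

`Hilb P` is the completion of `K / ker P` with respect to `[P ·, ·]`. `UniformSpace.Completion`
of a seminormed space divides out the vectors of seminorm zero, which form `ker P`. -/

/-- The vector space `K`, to be equipped with the semi-inner product `[P ·, ·]`. -/
def PreHilb (_P : PosOp K) : Type _ := K

instance (P : PosOp K) : AddCommGroup (PreHilb P) := inferInstanceAs (AddCommGroup K)
instance (P : PosOp K) : Module ℂ (PreHilb P) := inferInstanceAs (Module ℂ K)

def PreHilb.equiv (P : PosOp K) : PreHilb P ≃ₗ[ℂ] K := LinearEquiv.refl ℂ K

/-- The semi-inner product `(x, y) = [P x, y]`. -/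
@[reducible] def preCore (P : PosOp K) : PreInnerProductSpace.Core ℂ (PreHilb P) where
  inner x y := form (P.op (PreHilb.equiv P x)) (PreHilb.equiv P y)
  conj_inner_symm x y := by rw [form_conj]; exact (P.symm _ _).symm
  re_inner_nonneg x := (Complex.nonneg_iff.1 (P.nonneg (PreHilb.equiv P x))).1
  add_left x y z := by rw [map_add, map_add, form_add_left]
  smul_left x y r := by rw [map_smul, map_smul, form_smul_left]

instance (P : PosOp K) : SeminormedAddCommGroup (PreHilb P) :=
  @InnerProductSpace.Core.toSeminormedAddCommGroup ℂ (PreHilb P) _ _ _ (preCore P)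

instance (P : PosOp K) : InnerProductSpace ℂ (PreHilb P) := InnerProductSpace.ofCore (preCore P)

/-- The Hilbert space completion with respect to `[P ·, ·]`. -/
abbrev Hilb (P : PosOp K) : Type _ := UniformSpace.Completion (PreHilb P)

theorem inner_pre (P : PosOp K) (x y : PreHilb P) :
    ⟪x, y⟫_ℂ = form (P.op (PreHilb.equiv P x)) (PreHilb.equiv P y) := rfl

/-- The factor mapping `K → Hilb P`. -/
def factorMap (P : PosOp K) : K →L[ℂ] Hilb P :=
  LinearMap.mkContinuous
    ((UniformSpace.Completion.toComplL (𝕜 := ℂ) (E := PreHilb P)).toLinearMap ∘ₗ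
      (PreHilb.equiv P).symm.toLinearMap)
    (Real.sqrt ‖KreinSpace.J ∘L P.op‖) fun x => by
      have h1 : ‖(PreHilb.equiv P).symm x‖ ^ 2 ≤ ‖KreinSpace.J ∘L P.op‖ * ‖x‖ ^ 2 := by
        rw [InnerProductSpace.norm_sq_eq_re_inner (𝕜 := ℂ), inner_pre]
        calc _ ≤ ‖form (P.op x) x‖ := Complex.re_le_norm _
          _ ≤ ‖(KreinSpace.J ∘L P.op) x‖ * ‖x‖ := norm_inner_le_norm _ _
          _ ≤ ‖KreinSpace.J ∘L P.op‖ * ‖x‖ * ‖x‖ := by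
            gcongr; exact ContinuousLinearMap.le_opNorm _ _
          _ = _ := by ring
      have h2 := Real.sqrt_le_sqrt h1
      rw [Real.sqrt_sq (norm_nonneg _), Real.sqrt_mul (norm_nonneg _),
        Real.sqrt_sq (norm_nonneg _)] at h2
      simpa using h2

theorem inner_factorMap (P : PosOp K) (x y : K) :
    ⟪factorMap P x, factorMap P y⟫_ℂ = form (P.op x) y := by
  exact (UniformSpace.Completion.inner_coe _ _).trans (inner_pre P _ _)

theorem denseRange_factorMap (P : PosOp K) : DenseRange (factorMap P) := by
  exact UniformSpace.Completion.denseRange_coe.comp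
    (PreHilb.equiv P).symm.surjective.denseRange (UniformSpace.Completion.continuous_coe _)

/-- `T : Hilb P → K`, the Krein space adjoint of the factor mapping. It is injective, its adjoint
`T⁺` is the factor mapping and `T T⁺ = P`. -/
def embed (P : PosOp K) : Hilb P →L[ℂ] K :=
  KreinSpace.J ∘L ContinuousLinearMap.adjoint (factorMap P)

theorem hkadj_embed (P : PosOp K) : hkadj (embed P) = factorMap P := by
  ext x
  simp [hkadj, embed, ContinuousLinearMap.adjoint_comp, KreinSpace.adjoint_J, J_J]

theorem embed_comp_hkadj (P : PosOp K) : embed P ∘L hkadj (embed P) = P.op := by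
  ext x
  rw [hkadj_embed]
  have : (ContinuousLinearMap.adjoint (factorMap P)) (factorMap P x) = KreinSpace.J (P.op x) := by
    refine ext_inner_right ℂ fun y => ?_
    rw [ContinuousLinearMap.adjoint_inner_left, inner_factorMap, form]
  simp [embed, this, J_J]

theorem embed_injective (P : PosOp K) : Function.Injective (embed P) := by
  rw [injective_iff_map_eq_zero]
  intro h hh
  have h1 : ∀ y : K, ⟪h, factorMap P y⟫_ℂ = 0 := fun y => by
    rw [← hkadj_embed, ← form_hkadj, hh]; simp [form]
  exact (denseRange_factorMap P).eq_zero_of_inner_left ℂ h1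

theorem kadj_comp_comm (P : PosOp K) (C : K →L[ℂ] K) (hC : C ∘L P.op = P.op ∘L C) :
    kadj C ∘L P.op = P.op ∘L kadj C := by
  have hJP : ContinuousLinearMap.adjoint P.op ∘L KreinSpace.J = KreinSpace.J ∘L P.op := by
    ext x
    refine ext_inner_right ℂ fun y => ?_
    have := P.symm x y
    simp only [form] at this
    simp only [ContinuousLinearMap.comp_apply, ContinuousLinearMap.adjoint_inner_left]
    exact this.symm
  ext x
  refine ext_inner_left ℂ fun y => ?_
  have e1 : ∀ u v : K, ⟪u, v⟫_ℂ = form (KreinSpace.J u) v := fun u v => by simp [form, J_J]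
  have e2 : ∀ u : K, C (P.op u) = P.op (C u) := fun u => DFunLike.congr_fun hC u
  simp only [ContinuousLinearMap.comp_apply, e1]
  rw [← form_kadj, ← P.symm, ← P.symm, ← form_kadj, e2]

theorem exists_bound_factorMap (P : PosOp K) (C : K →L[ℂ] K) (hC : C ∘L P.op = P.op ∘L C) :
    ∃ c : ℝ, ∀ x, ‖factorMap P (C x)‖ ≤ c * ‖factorMap P x‖ := by
  set Q : K →L[ℂ] K := kadj C * C with hQ
  have hC' : ∀ u : K, C (P.op u) = P.op (C u) := fun u => DFunLike.congr_fun hC u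
  have hQP : ∀ u : K, Q (P.op u) = P.op (Q u) := fun u => by
    have := DFunLike.congr_fun (kadj_comp_comm P C hC) (C u)
    simp only [ContinuousLinearMap.comp_apply] at this
    simp [hQ, hC', this]
  have hQn : ∀ (n : ℕ) (u : K), (Q ^ n) (P.op u) = P.op ((Q ^ n) u) := fun n => by
    induction n with
    | zero => intro u; simp
    | succ k ih => intro u; rw [pow_succ]; simp [hQP, ih]
  have hkC : ∀ u v : K, form (kadj C u) v = form u (C v) := fun u v => by
    rw [← form_conj, ← form_kadj, form_conj]
  have hQs : ∀ u v : K, form (Q u) v = form u (Q v) := fun u v => by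
    simp only [hQ, mul_apply_eq_comp]
    rw [hkC, form_kadj]
  have hQns : ∀ (n : ℕ) (u v : K), form ((Q ^ n) u) v = form u ((Q ^ n) v) := fun n => by
    induction n with
    | zero => intro u v; simp
    | succ k ih =>
      intro u v
      rw [pow_succ, mul_apply_eq_comp, ih, hQs, ← mul_apply_eq_comp,
        ← pow_succ', pow_succ]
  have key : ∀ (x y z : K), form (P.op x) x = form (P.op y) z →
      ‖factorMap P x‖ ^ 2 ≤ ‖factorMap P y‖ * ‖factorMap P z‖ := fun x y z h => by
    rw [InnerProductSpace.norm_sq_eq_re_inner (𝕜 := ℂ), inner_factorMap, h, ← inner_factorMap]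
    exact (Complex.re_le_norm _).trans (norm_inner_le_norm _ _)
  have k1 : ∀ x, ‖factorMap P (C x)‖ ^ 2 ≤ ‖factorMap P (Q x)‖ * ‖factorMap P x‖ := fun x =>
    key _ _ _ (by rw [← hC', ← hkC]; exact congrArg (fun u => form u x) (hQP x))
  have k2 : ∀ (n : ℕ) x, ‖factorMap P ((Q ^ n) x)‖ ^ 2 ≤
      ‖factorMap P ((Q ^ (n + n)) x)‖ * ‖factorMap P x‖ := fun n x =>
    key _ _ _ (by
      rw [← hQns, hQn, pow_add, mul_apply_eq_comp])
  set q : ℝ := ‖Q‖ + 1 with hq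
  have hq0 : 0 < q := by positivity
  have k3 : ∀ x, ‖factorMap P (Q x)‖ ≤ q * ‖factorMap P x‖ := fun x => by
    rcases (norm_nonneg (factorMap P x)).eq_or_lt with hb | hb
    · have := k2 1 x
      rw [← hb, mul_zero, pow_one] at this
      rw [← hb, mul_zero]
      nlinarith [norm_nonneg (factorMap P (Q x))]
    set b := ‖factorMap P x‖ with hbdef
    have ind : ∀ n : ℕ, b * ‖factorMap P (Q x)‖ ^ (2 ^ n) ≤
        ‖factorMap P ((Q ^ (2 ^ n)) x)‖ * b ^ (2 ^ n) := fun n => by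
      induction n with
      | zero => simp [mul_comm]
      | succ n ih =>
        have h2 := k2 (2 ^ n) x
        rw [← two_mul, ← pow_succ'] at h2
        refine le_of_mul_le_mul_left ?_ hb
        calc b * (b * ‖factorMap P (Q x)‖ ^ 2 ^ (n + 1))
            = (b * ‖factorMap P (Q x)‖ ^ (2 ^ n)) ^ 2 := by ring
          _ ≤ (‖factorMap P ((Q ^ (2 ^ n)) x)‖ * b ^ (2 ^ n)) ^ 2 := by gcongr
          _ = ‖factorMap P ((Q ^ (2 ^ n)) x)‖ ^ 2 * b ^ (2 ^ (n + 1)) := by ring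
          _ ≤ (‖factorMap P ((Q ^ (2 ^ (n + 1))) x)‖ * b) * b ^ (2 ^ (n + 1)) := by gcongr
          _ = _ := by ring
    by_contra! hlt
    have hr : 1 < ‖factorMap P (Q x)‖ / (q * b) := (one_lt_div (by positivity)).2 hlt
    obtain ⟨n, hn⟩ := pow_unbounded_of_one_lt (‖factorMap P‖ * ‖x‖ / b) hr
    have hn2 := hn.trans_le (pow_le_pow_right₀ hr.le (Nat.lt_two_pow_self (n := n)).le)
    rw [div_pow, div_lt_div_iff₀ hb (by positivity)] at hn2
    have hle : ‖factorMap P ((Q ^ (2 ^ n)) x)‖ ≤ ‖factorMap P‖ * (q ^ (2 ^ n) * ‖x‖) :=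
      (ContinuousLinearMap.le_opNorm _ _).trans (by
        gcongr
        refine (ContinuousLinearMap.le_opNorm _ _).trans ?_
        gcongr
        refine (norm_pow_le' Q (by positivity)).trans ?_
        gcongr
        linarith)
    have h3 := (ind n).trans (mul_le_mul_of_nonneg_right hle (by positivity))
    rw [mul_pow] at hn2
    nlinarith
  refine ⟨Real.sqrt q, fun x => ?_⟩
  refine (sq_le_sq₀ (by positivity) (by positivity)).1 ?_
  rw [mul_pow, Real.sq_sqrt hq0.le]
  calc _ ≤ _ := k1 x
    _ ≤ q * ‖factorMap P x‖ * ‖factorMap P x‖ := by gcongr; exact k3 x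
    _ = _ := by ring

/-- For `C ∈ (T T⁺)'` the operator `T⁻¹ C T` is defined on all of `Hilb P` and bounded. -/
theorem exists_transport (P : PosOp K) (C : K →L[ℂ] K) (hC : C ∘L P.op = P.op ∘L C) :
    ∃ D : Hilb P →L[ℂ] Hilb P, embed P ∘L D = C ∘L embed P := by
  set D : Hilb P →L[ℂ] Hilb P := ((factorMap P ∘L C : K →L[ℂ] Hilb P) : K →ₗ[ℂ] Hilb P).extendOfNorm
    (factorMap P : K →ₗ[ℂ] Hilb P) with hD
  have h1 : ∀ x, D (factorMap P x) = factorMap P (C x) := fun x =>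
    LinearMap.extendOfNorm_eq (denseRange_factorMap P) (exists_bound_factorMap P C hC) x
  have h2 : ∀ x, embed P (factorMap P x) = P.op x := fun x => by
    have := DFunLike.congr_fun (embed_comp_hkadj P) x
    rwa [hkadj_embed] at this
  refine ⟨D, ?_⟩
  refine ContinuousLinearMap.coeFn_injective ?_
  refine (denseRange_factorMap P).equalizer (by fun_prop) (by fun_prop) ?_
  funext x
  simp only [Function.comp_apply, ContinuousLinearMap.comp_apply, h1, h2]
  exact (DFunLike.congr_fun hC x).symm

open Classical in
/-- `Θ(C) = T⁻¹ C T` for `C ∈ (T T⁺)'`: the (unique, as `T` is injective) bounded operator `D` on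
`Hilb P` with `T D = C T`. Set to `0` if there is none, which does not happen for `C ∈ (T T⁺)'`. -/
def transport (P : PosOp K) (C : K →L[ℂ] K) : Hilb P →L[ℂ] Hilb P :=
  if h : ∃ D : Hilb P →L[ℂ] Hilb P, embed P ∘L D = C ∘L embed P then h.choose else 0

theorem embed_comp_transport (P : PosOp K) (C : K →L[ℂ] K) (hC : C ∘L P.op = P.op ∘L C) :
    embed P ∘L transport P C = C ∘L embed P := by
  rw [transport, dif_pos (exists_transport P C hC)]
  exact (exists_transport P C hC).choose_spec

/-- `Ξ(D) = T D T⁺`. -/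
def lift (P : PosOp K) (D : Hilb P →L[ℂ] Hilb P) : K →L[ℂ] K :=
  embed P ∘L D ∘L hkadj (embed P)

end Krein

/-! ## The spectral measure of a normal operator on a Hilbert space -/

section Spectral
variable {H : Type*} [NormedAddCommGroup H] [InnerProductSpace ℂ H] [CompleteSpace H]

/-- The positive functional `g ↦ (g(D) x, x)` on the real `g ∈ C_c(ℂ)`, where `g(D)` is given by the
continuous functional calculus of the normal operator `D`. -/
def calcFunctional (D : H →L[ℂ] H) (x : H) : C_c(ℂ, ℝ) →ₚ[ℝ] ℝ :=
  PositiveLinearMap.mk₀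
    { toFun := fun g => (⟪x, cfc (fun z => (g z : ℂ)) D x⟫_ℂ).re
      map_add' := fun f g => by
        have hf : Continuous fun z => ((f z : ℝ) : ℂ) := Complex.continuous_ofReal.comp f.continuous
        have hg : Continuous fun z => ((g z : ℝ) : ℂ) := Complex.continuous_ofReal.comp g.continuous
        rw [show (fun z => (((f + g) z : ℝ) : ℂ)) = fun z => (f z : ℂ) + (g z : ℂ) by
          ext z; simp, cfc_add D _ _ hf.continuousOn hg.continuousOn]
        simp
      map_smul' := fun c g => by
        have hg : Continuous fun z => ((g z : ℝ) : ℂ) := Complex.continuous_ofReal.comp g.continuous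
        rw [show (fun z => (((c • g) z : ℝ) : ℂ)) = fun z => (c : ℂ) * (g z : ℂ) by
          ext z; simp, cfc_const_mul (c : ℂ) _ D hg.continuousOn]
        simp }
    fun g hg => by
      have h : 0 ≤ cfc (fun z => (g z : ℂ)) D := cfc_nonneg fun z _ => by
        simpa using hg z
      have h2 := (ContinuousLinearMap.nonneg_iff_isPositive _).1 h
      exact h2.re_inner_nonneg_right x

/-- The measure `Δ ↦ (E(Δ) x, x)`, where `E` is the spectral measure of the normal operator `D`: the
unique regular Borel measure that represents `g ↦ (g(D) x, x)`. -/
def scalarMeasure (D : H →L[ℂ] H) (x : H) : Measure ℂ := RealRMK.rieszMeasure (calcFunctional D x)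

theorem calcFunctional_apply (D : H →L[ℂ] H) (x : H) (g : C_c(ℂ, ℝ)) :
    calcFunctional D x g = (⟪x, cfc (fun z => (g z : ℂ)) D x⟫_ℂ).re := rfl

instance (D : H →L[ℂ] H) (x : H) : (scalarMeasure D x).Regular := by
  unfold scalarMeasure; infer_instance

theorem scalarMeasure_univ_le (D : H →L[ℂ] H) (x : H) :
    scalarMeasure D x Set.univ ≤ ENNReal.ofReal (‖x‖ ^ 2) := by
  rw [isOpen_univ.measure_eq_iSup_isCompact]
  refine iSup_le fun L => iSup_le fun _ => iSup_le fun hL => ?_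
  obtain ⟨f, hf1, -, hfc, hf⟩ := exists_continuous_one_zero_of_isCompact hL isClosed_empty
    (Set.disjoint_empty L)
  refine (RealRMK.rieszMeasure_le_of_eq_one (f := ⟨f, hfc⟩) _ (fun z => (hf z).1) hL
    (fun z hz => hf1 hz)).trans (ENNReal.ofReal_le_ofReal ?_)
  rw [calcFunctional_apply]
  have h1 : ‖cfc (fun z => ((f z : ℝ) : ℂ)) D‖ ≤ 1 := norm_cfc_le zero_le_one fun z _ => by
    simpa [abs_of_nonneg (hf z).1] using (hf z).2
  calc _ ≤ ‖⟪x, cfc (fun z => ((f z : ℝ) : ℂ)) D x⟫_ℂ‖ := Complex.re_le_norm _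
    _ ≤ ‖x‖ * ‖cfc (fun z => ((f z : ℝ) : ℂ)) D x‖ := norm_inner_le_norm _ _
    _ ≤ ‖x‖ * (1 * ‖x‖) := by
      gcongr; exact ContinuousLinearMap.le_of_opNorm_le _ h1 x
    _ = _ := by ring

instance (D : H →L[ℂ] H) (x : H) : IsFiniteMeasure (scalarMeasure D x) :=
  ⟨(scalarMeasure_univ_le D x).trans_lt ENNReal.ofReal_lt_top⟩

theorem integral_scalarMeasure_real (D : H →L[ℂ] H) (x : H) (g : ℂ → ℝ) (hg : Continuous g)
    (hc : HasCompactSupport g) :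
    ∫ z, (g z : ℂ) ∂(scalarMeasure D x) = ⟪x, cfc (fun z => (g z : ℂ)) D x⟫_ℂ := by
  have h1 := RealRMK.integral_rieszMeasure (calcFunctional D x) ⟨⟨g, hg⟩, hc⟩
  rw [calcFunctional_apply] at h1
  rw [integral_complex_ofReal, scalarMeasure]
  refine (congrArg Complex.ofReal h1).trans ?_
  have h2 : IsSelfAdjoint (cfc (fun z => (g z : ℂ)) D) := by
    rw [IsSelfAdjoint, ← cfc_star]; simp
  have h3 := h2.isSymmetric
  apply Complex.ext
  · rfl
  · have := h3 x x
    simp only [ContinuousLinearMap.coe_coe] at this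
    rw [← inner_conj_symm] at this
    simpa using (Complex.conj_eq_iff_im.1 this).symm

theorem integral_scalarMeasure (D : H →L[ℂ] H) (x : H) (g : ℂ → ℂ) (hg : Continuous g)
    (hc : HasCompactSupport g) :
    ∫ z, g z ∂(scalarMeasure D x) = ⟪x, cfc g D x⟫_ℂ := by
  have hr : Continuous fun z => (g z).re := Complex.continuous_re.comp hg
  have hi : Continuous fun z => (g z).im := Complex.continuous_im.comp hg
  have hrc : HasCompactSupport fun z => (g z).re := hc.comp_left (g := Complex.re) rfl
  have hic : HasCompactSupport fun z => (g z).im := hc.comp_left (g := Complex.im) rfl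
  have e : g = fun z => (((g z).re : ℝ) : ℂ) + Complex.I * (((g z).im : ℝ) : ℂ) := by
    ext z; rw [mul_comm]; exact (Complex.re_add_im _).symm
  have hr' : Continuous fun z => (((g z).re : ℝ) : ℂ) := Complex.continuous_ofReal.comp hr
  have hi' : Continuous fun z => (((g z).im : ℝ) : ℂ) := Complex.continuous_ofReal.comp hi
  have hrc' : HasCompactSupport fun z => (((g z).re : ℝ) : ℂ) :=
    hrc.comp_left (g := Complex.ofReal) rfl
  have hic' : HasCompactSupport fun z => (((g z).im : ℝ) : ℂ) :=
    hic.comp_left (g := Complex.ofReal) rfl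
  conv_lhs => rw [e]
  conv_rhs => rw [e]
  rw [integral_add (hr'.integrable_of_hasCompactSupport hrc')
    ((hi'.integrable_of_hasCompactSupport hic').const_mul _), integral_const_mul,
    integral_scalarMeasure_real D x _ hr hrc, integral_scalarMeasure_real D x _ hi hic,
    cfc_add D (fun z => (((g z).re : ℝ) : ℂ)) (fun z => Complex.I * (((g z).im : ℝ) : ℂ))
      hr'.continuousOn (continuous_const.mul hi').continuousOn,
    cfc_const_mul _ _ D hi'.continuousOn]
  simp

theorem mem_closure_quadratic (D : H →L[ℂ] H) (f : ℂ → ℂ) (hf : Measurable f) (C : ℝ)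
    (hC : ∀ z, ‖f z‖ ≤ C) :
    (fun u => ∫ z, f z ∂(scalarMeasure D u)) ∈
      closure (Set.range fun (S : H →L[ℂ] H) (u : H) => ⟪u, S u⟫_ℂ) := by
  rw [mem_closure_iff_nhds]
  intro t ht
  rw [nhds_pi, Filter.mem_pi] at ht
  obtain ⟨I, hI, U, hU, hUt⟩ := ht
  have hε : ∃ ε > 0, ∀ u ∈ I, Metric.closedBall (∫ z, f z ∂(scalarMeasure D u)) ε ⊆ U u := by
    have : ∀ᶠ ε in nhdsWithin (0 : ℝ) (Set.Ioi 0), ∀ u ∈ I,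
        Metric.closedBall (∫ z, f z ∂(scalarMeasure D u)) ε ⊆ U u := by
      rw [hI.eventually_all]
      intro u _
      obtain ⟨r, hr, hrU⟩ := Metric.nhds_basis_closedBall.mem_iff.1 (hU u)
      filter_upwards [Ioc_mem_nhdsGT hr] with ε hε
      exact (Metric.closedBall_subset_closedBall hε.2).trans hrU
    obtain ⟨ε, h1, h2⟩ := (this.and self_mem_nhdsWithin).exists
    exact ⟨ε, h2, h1⟩
  obtain ⟨ε, hε, hεU⟩ := hε
  set ν : Measure ℂ := ∑ u ∈ hI.toFinset, scalarMeasure D u with hν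
  have hint : ∀ (μ : Measure ℂ) [IsFiniteMeasure μ], Integrable f μ := fun μ _ =>
    Integrable.of_bound hf.aestronglyMeasurable C (Filter.Eventually.of_forall hC)
  have : IsFiniteMeasure ν := by rw [hν]; infer_instance
  obtain ⟨g, hgc, hg, hgcont, hgi⟩ := (hint ν).exists_hasCompactSupport_integral_sub_le hε
  refine ⟨fun u => ⟪u, cfc g D u⟫_ℂ, hUt fun u hu => hεU u hu ?_, ⟨_, rfl⟩⟩
  have hgu := hgcont.integrable_of_hasCompactSupport (μ := scalarMeasure D u) hgc
  rw [← integral_scalarMeasure D u g hgcont hgc, Metric.mem_closedBall, dist_comm, dist_eq_norm,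
    ← integral_sub (hint _) hgu]
  refine (norm_integral_le_integral_norm _).trans (le_trans ?_ hg)
  refine integral_mono_measure ?_ (Filter.Eventually.of_forall fun z => norm_nonneg _)
    ((hint ν).sub hgi).norm
  rw [hν]
  refine Measure.le_iff.2 fun s hs => ?_
  rw [Measure.finsetSum_apply]
  exact Finset.single_le_sum (f := fun v => scalarMeasure D v s) (fun _ _ => zero_le)
    (hI.mem_toFinset.2 hu)

/-- The quadratic form `x ↦ ∫ f d(E x, x)` belongs to a bounded operator. -/
theorem exists_spectralIntegral (D : H →L[ℂ] H) (f : ℂ → ℂ) (hf : Measurable f) (C : ℝ)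
    (hC : ∀ z, ‖f z‖ ≤ C) :
    ∃ S : H →L[ℂ] H, ∀ x, ⟪x, S x⟫_ℂ = ∫ z, f z ∂(scalarMeasure D x) := by
  set m : H → ℂ := fun u => ∫ z, f z ∂(scalarMeasure D u) with hm
  have hC0 : 0 ≤ C := (norm_nonneg _).trans (hC 0)
  have hmb : ∀ u, ‖m u‖ ≤ C * ‖u‖ ^ 2 := fun u => by
    refine (norm_integral_le_of_norm_le_const (Filter.Eventually.of_forall hC)).trans ?_
    gcongr
    exact ENNReal.toReal_le_of_le_ofReal (by positivity) (scalarMeasure_univ_le D u)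
  set 𝓕 : Filter (H →L[ℂ] H) := Filter.comap (fun S u => ⟪u, S u⟫_ℂ) (nhds m) with h𝓕
  have : 𝓕.NeBot := by
    rw [h𝓕, Filter.comap_neBot_iff]
    intro t ht
    obtain ⟨_, h1, ⟨S, rfl⟩⟩ := mem_closure_iff_nhds.1 (mem_closure_quadratic D f hf C hC) t ht
    exact ⟨S, h1⟩
  have ht : ∀ u, Filter.Tendsto (fun S : H →L[ℂ] H => ⟪u, S u⟫_ℂ) 𝓕 (nhds (m u)) := fun u =>
    ((continuous_apply u).tendsto m).comp Filter.tendsto_comap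
  set B : H → H → ℂ := fun y x => conj ((conj (m (x + y)) - conj (m (x - y)) -
    Complex.I * conj (m (x + Complex.I • y)) + Complex.I * conj (m (x - Complex.I • y))) / 4) with hB
  have hBt : ∀ y x, Filter.Tendsto (fun S : H →L[ℂ] H => ⟪y, S x⟫_ℂ) 𝓕 (nhds (B y x)) := by
    intro y x
    have hc : ∀ u, Filter.Tendsto (fun S : H →L[ℂ] H => ⟪S u, u⟫_ℂ) 𝓕 (nhds (conj (m u))) :=
      fun u => by
        simpa [Function.comp_def] using (Complex.continuous_conj.tendsto _).comp (ht u)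
    have := ((((hc (x + y)).sub (hc (x - y))).sub ((hc (x + Complex.I • y)).const_mul Complex.I)).add
      ((hc (x - Complex.I • y)).const_mul Complex.I)).div_const 4
    have := (Complex.continuous_conj.tendsto _).comp this
    refine this.congr fun S => ?_
    have := inner_map_polarization' (S : H →ₗ[ℂ] H) x y
    simp only [ContinuousLinearMap.coe_coe] at this
    simp only [Function.comp_apply]
    rw [← this, inner_conj_symm]
  have hBb : ∀ y x, ‖B y x‖ ≤ C * (‖x‖ + ‖y‖) ^ 2 := fun y x => by
    have hI : ‖Complex.I • y‖ = ‖y‖ := by simp [norm_smul]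
    have b1 : ‖m (x + y)‖ ≤ C * (‖x‖ + ‖y‖) ^ 2 := (hmb _).trans (by
      gcongr; exact norm_add_le _ _)
    have b2 : ‖m (x - y)‖ ≤ C * (‖x‖ + ‖y‖) ^ 2 := (hmb _).trans (by
      gcongr; exact norm_sub_le _ _)
    have b3 : ‖m (x + Complex.I • y)‖ ≤ C * (‖x‖ + ‖y‖) ^ 2 := (hmb _).trans (by
      gcongr; exact (norm_add_le _ _).trans (by rw [hI]))
    have b4 : ‖m (x - Complex.I • y)‖ ≤ C * (‖x‖ + ‖y‖) ^ 2 := (hmb _).trans (by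
      gcongr; exact (norm_sub_le _ _).trans (by rw [hI]))
    rw [hB]
    simp only [RCLike.norm_conj, norm_div]
    rw [div_le_iff₀ (by simp)]
    refine (norm_add_le _ _).trans ?_
    refine (add_le_add_left ((norm_sub_le _ _).trans
      (add_le_add_left (norm_sub_le _ _) _)) _).trans ?_
    simp only [norm_mul, Complex.norm_I, one_mul, RCLike.norm_conj]
    norm_num
    linarith
  have hadd : ∀ y x x', B y (x + x') = B y x + B y x' := fun y x x' =>
    tendsto_nhds_unique (hBt y (x + x')) (((hBt y x).add (hBt y x')).congr fun S => by
      simp)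
  have hsmul : ∀ (c : ℂ) y x, B y (c • x) = c * B y x := fun c y x =>
    tendsto_nhds_unique (hBt y (c • x)) (((hBt y x).const_mul c).congr fun S => by
      simp)
  have hadd' : ∀ y y' x, B (y + y') x = B y x + B y' x := fun y y' x =>
    tendsto_nhds_unique (hBt (y + y') x) (((hBt y x).add (hBt y' x)).congr fun S => by
      simp)
  have hsmul' : ∀ (c : ℂ) y x, B (c • y) x = conj c * B y x := fun c y x =>
    tendsto_nhds_unique (hBt (c • y) x) (((hBt y x).const_mul (conj c)).congr fun S => by
      simp [mul_comm])
  have hBb' : ∀ y x, ‖B y x‖ ≤ (4 * C) * ‖y‖ * ‖x‖ := fun y x => by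
    by_cases hy : y = 0
    · have : B y x = 0 := by simpa [hy] using hsmul' 0 0 x
      rw [this, norm_zero]; positivity
    by_cases hx : x = 0
    · have : B y x = 0 := by simpa [hx] using hsmul 0 y 0
      rw [this, norm_zero]; positivity
    have h1 : (0 : ℝ) < ‖y‖ := norm_pos_iff.2 hy
    have h2 : (0 : ℝ) < ‖x‖ := norm_pos_iff.2 hx
    have h := hBb (((‖y‖ : ℝ) : ℂ)⁻¹ • y) (((‖x‖ : ℝ) : ℂ)⁻¹ • x)
    rw [hsmul, hsmul', norm_mul, norm_mul, norm_smul, norm_smul] at h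
    simp only [RCLike.norm_conj, norm_inv, Complex.norm_real, norm_norm,
      inv_mul_cancel₀ h1.ne', inv_mul_cancel₀ h2.ne'] at h
    rw [← mul_assoc, ← mul_inv, inv_mul_le_iff₀ (by positivity)] at h
    linarith
  set Bc : H →L⋆[ℂ] H →L[ℂ] ℂ := LinearMap.mkContinuous₂
    (LinearMap.mk₂'ₛₗ (starRingEnd ℂ) (RingHom.id ℂ) B hadd' (fun c y x => hsmul' c y x)
      (fun y x x' => hadd y x x') (fun c y x => hsmul c y x)) (4 * C) hBb' with hBc
  refine ⟨ContinuousLinearMap.adjoint (InnerProductSpace.continuousLinearMapOfBilin Bc),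
    fun x => ?_⟩
  rw [ContinuousLinearMap.adjoint_inner_right, InnerProductSpace.continuousLinearMapOfBilin_apply]
  exact tendsto_nhds_unique (hBt x x) (ht x)

open Classical in
/-- The operator `∫_{σ(D)} f dE`, where `E` is the spectral measure of the normal operator `D`: the
(unique, by polarization) `S ∈ B(H)` with `(S x, x) = ∫_{σ(D)} f d(E x, x)` for all `x`. It exists
for bounded Borel measurable `f`, see `inner_spectralIntegral`; it is set to `0` if there is none.
The values of `E` itself are the operators `E(Δ) = ∫ 1_Δ dE`. -/
def spectralIntegral (D : H →L[ℂ] H) (f : ℂ → ℂ) : H →L[ℂ] H :=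
  if h : ∃ S : H →L[ℂ] H, ∀ x, ⟪x, S x⟫_ℂ = ∫ z in spectrum ℂ D, f z ∂(scalarMeasure D x)
  then h.choose else 0

theorem inner_spectralIntegral (D : H →L[ℂ] H) (f : ℂ → ℂ) (hf : Measurable f)
    (hb : ∃ C : ℝ, ∀ z, ‖f z‖ ≤ C) (x : H) :
    ⟪x, spectralIntegral D f x⟫_ℂ = ∫ z in spectrum ℂ D, f z ∂(scalarMeasure D x) := by
  obtain ⟨C, hC⟩ := hb
  have hm : MeasurableSet (spectrum ℂ D) := (spectrum.isClosed D).measurableSet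
  have h : ∃ S : H →L[ℂ] H, ∀ x, ⟪x, S x⟫_ℂ = ∫ z in spectrum ℂ D, f z ∂(scalarMeasure D x) := by
    simp only [← integral_indicator hm]
    exact exists_spectralIntegral D _ (hf.indicator hm) C fun z =>
      (norm_indicator_le_norm_self f z).trans (hC z)
  rw [spectralIntegral, dif_pos h]
  exact h.choose_spec x

end Spectral

/-! ## The algebra `ℂ[x, y] × 𝔅(X)^m` with the twisted multiplication -/

section Algebra

/-- `𝔅(X)`: the `*`-algebra of bounded Borel measurable functions `X → ℂ`. -/
def BddMeas (X : Set ℂ) : StarSubalgebra ℂ (X → ℂ) where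
  carrier := {f | Measurable f ∧ ∃ C : ℝ, ∀ z, ‖f z‖ ≤ C}
  mul_mem' := by
    rintro f g ⟨hf, C, hC⟩ ⟨hg, C', hC'⟩
    refine ⟨hf.mul hg, C * C', fun z => ?_⟩
    rw [Pi.mul_apply, norm_mul]
    exact mul_le_mul (hC z) (hC' z) (norm_nonneg _) ((norm_nonneg _).trans (hC z))
  add_mem' := by
    rintro f g ⟨hf, C, hC⟩ ⟨hg, C', hC'⟩
    exact ⟨hf.add hg, C + C', fun z => (norm_add_le _ _).trans (add_le_add (hC z) (hC' z))⟩
  algebraMap_mem' := fun c => ⟨measurable_const, ‖c‖, fun _ => le_rfl⟩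
  star_mem' := by
    rintro f ⟨hf, C, hC⟩
    refine ⟨Complex.continuous_conj.measurable.comp hf, C, fun z => ?_⟩
    simpa using hC z

/-- `r(z) = r(Re z, Im z)` for `r ∈ ℂ[x, y]` and `z ∈ ℂ`. -/
def polyVal (r : Poly) (z : ℂ) : ℂ := MvPolynomial.eval ![(z.re : ℂ), (z.im : ℂ)] r

theorem continuous_polyVal (r : Poly) : Continuous (polyVal r) := by
  refine r.continuous_eval.comp (continuous_pi fun i => ?_)
  fin_cases i
  · exact Complex.continuous_ofReal.comp Complex.continuous_re
  · exact Complex.continuous_ofReal.comp Complex.continuous_im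

/-- `r^#`, where `r^#(x, y)` is the complex conjugate of `r` at the conjugates of `x` and `y`: the
coefficients are conjugated. -/
def sharp (r : Poly) : Poly := MvPolynomial.map (starRingEnd ℂ) r

theorem polyVal_sharp (r : Poly) (z : ℂ) : polyVal (sharp r) z = conj (polyVal r z) := by
  rw [polyVal, sharp, polyVal, MvPolynomial.eval_map, MvPolynomial.eval, MvPolynomial.coe_eval₂Hom,
    MvPolynomial.hom_eval₂]
  congr 1
  funext i
  fin_cases i <;> simp

/-- `r ∈ ℂ[x, y]` as the function `z ↦ r(Re z, Im z)` on the compact set `X`. -/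
def polyFn (X : TopologicalSpace.Compacts ℂ) : Poly →ₐ[ℂ] BddMeas (X : Set ℂ) where
  toFun r := ⟨fun z => polyVal r z,
    ((continuous_polyVal r).comp continuous_subtype_val).measurable, by
    obtain ⟨C, hC⟩ := X.isCompact.exists_bound_of_continuousOn (continuous_polyVal r).continuousOn
    exact ⟨C, fun z => hC z z.2⟩⟩
  map_one' := by ext z; simp [polyVal]
  map_mul' r s := by ext z; simp [polyVal]
  map_zero' := by ext z; simp [polyVal]
  map_add' r s := by ext z; simp [polyVal]
  commutes' c := by ext z; simp [polyVal]

variable {m : ℕ}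

/-- The elements `(r, f_1, …, f_m)` of `ℛ = ℂ[x, y] × 𝔅(X)^m`. -/
@[ext]
structure CalcAlg (X : TopologicalSpace.Compacts ℂ) (p : Fin m → MvPolynomial (Fin 2) ℝ) where
  poly : Poly
  fn : Fin m → BddMeas (X : Set ℂ)

namespace CalcAlg
variable {X : TopologicalSpace.Compacts ℂ} {p : Fin m → MvPolynomial (Fin 2) ℝ}

def toProd : CalcAlg X p ≃ Poly × (Fin m → BddMeas (X : Set ℂ)) where
  toFun a := (a.poly, a.fn)
  invFun a := ⟨a.1, a.2⟩

instance : AddCommGroup (CalcAlg X p) := toProd.addCommGroup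
instance : Module ℂ (CalcAlg X p) := toProd.module ℂ

/-- The function `∑ f_k p_k` on `X`. -/
def wsum (p : Fin m → MvPolynomial (Fin 2) ℝ) (f : Fin m → BddMeas (X : Set ℂ)) :
    BddMeas (X : Set ℂ) :=
  ∑ k, f k * polyFn X (complexify (p k))

/-- `(r, f) (s, g) = (r s, (r g_j + s f_j + f_j ∑ g_k p_k)_j)`. -/
instance : Mul (CalcAlg X p) where
  mul a b := ⟨a.poly * b.poly, fun j =>
    polyFn X a.poly * b.fn j + polyFn X b.poly * a.fn j + a.fn j * wsum p b.fn⟩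

instance : One (CalcAlg X p) where
  one := ⟨1, 0⟩

@[simp] theorem add_poly (a b : CalcAlg X p) : (a + b).poly = a.poly + b.poly := rfl
@[simp] theorem add_fn (a b : CalcAlg X p) : (a + b).fn = a.fn + b.fn := rfl
@[simp] theorem zero_poly : (0 : CalcAlg X p).poly = 0 := rfl
@[simp] theorem zero_fn : (0 : CalcAlg X p).fn = 0 := rfl
@[simp] theorem sub_poly (a b : CalcAlg X p) : (a - b).poly = a.poly - b.poly := rfl
@[simp] theorem sub_fn (a b : CalcAlg X p) : (a - b).fn = a.fn - b.fn := rfl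
@[simp] theorem neg_poly (a : CalcAlg X p) : (-a).poly = -a.poly := rfl
@[simp] theorem neg_fn (a : CalcAlg X p) : (-a).fn = -a.fn := rfl
@[simp] theorem smul_poly (c : ℂ) (a : CalcAlg X p) : (c • a).poly = c • a.poly := rfl
@[simp] theorem smul_fn (c : ℂ) (a : CalcAlg X p) : (c • a).fn = c • a.fn := rfl
@[simp] theorem one_poly : (1 : CalcAlg X p).poly = 1 := rfl
@[simp] theorem one_fn : (1 : CalcAlg X p).fn = 0 := rfl
@[simp] theorem mul_poly (a b : CalcAlg X p) : (a * b).poly = a.poly * b.poly := rfl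
@[simp] theorem mul_fn (a b : CalcAlg X p) (j : Fin m) : (a * b).fn j =
    polyFn X a.poly * b.fn j + polyFn X b.poly * a.fn j + a.fn j * wsum p b.fn := rfl

theorem wsum_add (f g : Fin m → BddMeas (X : Set ℂ)) : wsum p (f + g) = wsum p f + wsum p g := by
  simp [wsum, add_mul, Finset.sum_add_distrib]
@[simp] theorem wsum_zero : wsum p (0 : Fin m → BddMeas (X : Set ℂ)) = 0 := by simp [wsum]
theorem wsum_smul (c : ℂ) (f : Fin m → BddMeas (X : Set ℂ)) : wsum p (c • f) = c • wsum p f := by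
  simp [wsum, Finset.smul_sum]

theorem wsum_mul_fn (a b : CalcAlg X p) : wsum p (a * b).fn =
    polyFn X a.poly * wsum p b.fn + polyFn X b.poly * wsum p a.fn + wsum p a.fn * wsum p b.fn := by
  conv_lhs => rw [wsum]
  simp only [mul_fn, add_mul, Finset.sum_add_distrib]
  congr 1
  · congr 1 <;> · rw [wsum, Finset.mul_sum]; exact Finset.sum_congr rfl fun _ _ => mul_assoc _ _ _
  · nth_rewrite 2 [wsum]
    rw [Finset.sum_mul]
    exact Finset.sum_congr rfl fun _ _ => mul_right_comm _ _ _

instance : Ring (CalcAlg X p) where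
  __ := (inferInstance : AddCommGroup (CalcAlg X p))
  left_distrib a b c := by
    apply CalcAlg.ext
    · simp [mul_add]
    · funext j; simp only [mul_fn, add_poly, add_fn, Pi.add_apply, map_add, wsum_add]; ring
  right_distrib a b c := by
    apply CalcAlg.ext
    · simp [add_mul]
    · funext j; simp only [mul_fn, add_poly, add_fn, Pi.add_apply, map_add]; ring
  zero_mul a := by
    apply CalcAlg.ext
    · simp
    · funext j; simp
  mul_zero a := by
    apply CalcAlg.ext
    · simp
    · funext j; simp
  mul_assoc a b c := by
    apply CalcAlg.ext
    · simp [mul_assoc]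
    · funext j; simp only [mul_fn, mul_poly, map_mul, wsum_mul_fn]; ring
  one_mul a := by
    apply CalcAlg.ext
    · simp
    · funext j; simp
  mul_one a := by
    apply CalcAlg.ext
    · simp
    · funext j; simp
  zsmul := fun n a => n • a
  zsmul_zero' a := zero_zsmul a
  zsmul_succ' n a := by simpa using SubNegMonoid.zsmul_succ' n a
  zsmul_neg' n a := SubNegMonoid.zsmul_neg' n a

instance : Algebra ℂ (CalcAlg X p) := Algebra.ofModule
  (fun c a b => by
    apply CalcAlg.ext
    · simp
    · funext j
      simp only [mul_fn, smul_poly, smul_fn, Pi.smul_apply, map_smul, smul_mul_assoc,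
        mul_smul_comm, smul_add])
  (fun c a b => by
    apply CalcAlg.ext
    · simp
    · funext j
      simp only [mul_fn, smul_poly, smul_fn, Pi.smul_apply, map_smul, smul_mul_assoc,
        mul_smul_comm, smul_add, wsum_smul])

/-- `(r, f_1, …, f_m)^# = (r^#, conj f_1, …, conj f_m)`. -/
instance : Star (CalcAlg X p) := ⟨fun a => ⟨sharp a.poly, fun j => star (a.fn j)⟩⟩

@[simp] theorem star_poly (a : CalcAlg X p) : (star a).poly = sharp a.poly := rfl
@[simp] theorem star_fn (a : CalcAlg X p) : (star a).fn = star a.fn := rfl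

/-- The real variety `V_ℝ(I)` of `I = ⟨p_1, …, p_m⟩`, as a subset of `ℂ`. -/
def realZeros (p : Fin m → MvPolynomial (Fin 2) ℝ) : Set ℂ :=
  {z | ∀ k, polyVal (complexify (p k)) z = 0}

theorem polyVal_sum_mul (u : Fin m → Poly) {z : ℂ} (hz : z ∈ realZeros p) :
    polyVal (∑ k, u k * complexify (p k)) z = 0 := by
  have : ∀ k, MvPolynomial.eval ![(z.re : ℂ), (z.im : ℂ)] (complexify (p k)) = 0 := hz
  simp [polyVal, this]

theorem wsum_apply (f : Fin m → BddMeas (X : Set ℂ)) (z : (X : Set ℂ)) :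
    (wsum p f : BddMeas (X : Set ℂ)).1 z = ∑ k, (f k).1 z * polyVal (complexify (p k)) z := by
  simp [wsum]; rfl

/-- Membership of `(r, f_1, …, f_m)` in `𝒩`: `r + ∑ f_k p_k = 0` on `X \ V_ℝ(I)`, and there are
`u_1, …, u_m ∈ ℂ[x, y]` with `r = ∑ u_k p_k` and `f_j + u_j = 0` on `V_ℝ(I) ∩ X` for all `j`. -/
def MemNull (a : CalcAlg X p) : Prop :=
  (∀ z : (X : Set ℂ), (z : ℂ) ∉ realZeros p →
    polyVal a.poly z + ∑ k, (a.fn k).1 z * polyVal (complexify (p k)) z = 0) ∧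
  ∃ u : Fin m → Poly, a.poly = ∑ k, u k * complexify (p k) ∧
    ∀ j, ∀ z : (X : Set ℂ), (z : ℂ) ∈ realZeros p → (a.fn j).1 z + polyVal (u j) z = 0

theorem memNull_iff (a : CalcAlg X p) : a.MemNull ↔
    (∀ z : (X : Set ℂ), (z : ℂ) ∉ realZeros p → (polyFn X a.poly + wsum p a.fn).1 z = 0) ∧
    ∃ u : Fin m → Poly, a.poly = ∑ k, u k * complexify (p k) ∧
      ∀ j, ∀ z : (X : Set ℂ), (z : ℂ) ∈ realZeros p → (a.fn j + polyFn X (u j)).1 z = 0 := by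
  have : ∀ z, (polyFn X a.poly + wsum p a.fn).1 z =
      polyVal a.poly z + ∑ k, (a.fn k).1 z * polyVal (complexify (p k)) z := fun z => by
    rw [← wsum_apply]; rfl
  simp only [this]
  rfl

theorem val_mul (f g : BddMeas (X : Set ℂ)) (z) : (f * g).1 z = f.1 z * g.1 z := rfl
theorem val_add (f g : BddMeas (X : Set ℂ)) (z) : (f + g).1 z = f.1 z + g.1 z := rfl
theorem polyFn_val (r : Poly) (z : (X : Set ℂ)) : (polyFn X r).1 z = polyVal r z := rfl

theorem wsum_val_eq_zero (f : Fin m → BddMeas (X : Set ℂ)) (z : (X : Set ℂ))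
    (hz : (z : ℂ) ∈ realZeros p) : (wsum p f).1 z = 0 := by
  rw [wsum_apply]
  exact Finset.sum_eq_zero fun k _ => by rw [hz k, mul_zero]

theorem total_mul (a b : CalcAlg X p) : polyFn X (a * b).poly + wsum p (a * b).fn =
    (polyFn X a.poly + wsum p a.fn) * (polyFn X b.poly + wsum p b.fn) := by
  rw [wsum_mul_fn, mul_poly, map_mul]; ring

theorem MemNull.mul_left {b : CalcAlg X p} (hb : b.MemNull) (a : CalcAlg X p) :
    (a * b).MemNull := by
  rw [memNull_iff] at hb ⊢
  obtain ⟨h1, u, hu, h2⟩ := hb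
  refine ⟨fun z hz => ?_, fun k => a.poly * u k, ?_, fun j z hz => ?_⟩
  · rw [total_mul, val_mul, h1 z hz, mul_zero]
  · rw [mul_poly, hu, Finset.mul_sum]; exact Finset.sum_congr rfl fun _ _ => (mul_assoc _ _ _).symm
  · have h3 := h2 j z hz
    rw [val_add] at h3
    have h4 : (polyFn X b.poly).1 z = 0 := by rw [hu]; exact polyVal_sum_mul u hz
    have h5 := wsum_val_eq_zero b.fn z hz
    rw [mul_fn, map_mul]
    simp only [val_add, val_mul, h4, h5]
    linear_combination (polyFn X a.poly).1 z * h3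

theorem MemNull.mul_right {a : CalcAlg X p} (ha : a.MemNull) (b : CalcAlg X p) :
    (a * b).MemNull := by
  rw [memNull_iff] at ha ⊢
  obtain ⟨h1, u, hu, h2⟩ := ha
  refine ⟨fun z hz => ?_, fun k => b.poly * u k, ?_, fun j z hz => ?_⟩
  · rw [total_mul, val_mul, h1 z hz, zero_mul]
  · rw [mul_poly, hu, mul_comm, Finset.mul_sum]
    exact Finset.sum_congr rfl fun _ _ => (mul_assoc _ _ _).symm
  · have h3 := h2 j z hz
    rw [val_add] at h3
    have h4 : (polyFn X a.poly).1 z = 0 := by rw [hu]; exact polyVal_sum_mul u hz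
    have h5 := wsum_val_eq_zero b.fn z hz
    rw [mul_fn, map_mul]
    simp only [val_add, val_mul, h4, h5]
    linear_combination (polyFn X b.poly).1 z * h3

/-- The two-sided ideal `𝒩` of `ℛ`. -/
def nullIdeal (X : TopologicalSpace.Compacts ℂ) (p : Fin m → MvPolynomial (Fin 2) ℝ) :
    Ideal (CalcAlg X p) where
  carrier := {a | a.MemNull}
  add_mem' := by
    rintro a b ha hb
    rw [Set.mem_ofPred_eq, memNull_iff] at *
    obtain ⟨h1, u, hu, h2⟩ := ha
    obtain ⟨g1, v, hv, g2⟩ := hb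
    refine ⟨fun z hz => ?_, u + v, ?_, fun j z hz => ?_⟩
    · have e1 := h1 z hz
      have e2 := g1 z hz
      simp only [add_poly, add_fn, map_add, wsum_add, val_add] at *
      linear_combination e1 + e2
    · simp [hu, hv, add_mul, Finset.sum_add_distrib]
    · have e1 := h2 j z hz
      have e2 := g2 j z hz
      simp only [add_fn, Pi.add_apply, map_add, val_add] at *
      linear_combination e1 + e2
  zero_mem' := by
    rw [Set.mem_ofPred_eq, memNull_iff]
    exact ⟨fun z _ => by simp, 0, by simp, fun j z _ => by simp⟩
  smul_mem' a b hb := hb.mul_left a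

instance : (nullIdeal X p).IsTwoSided := ⟨fun b ha => MemNull.mul_right ha b⟩

theorem polyFn_sharp (r : Poly) : polyFn X (sharp r) = star (polyFn X r) := by
  ext z; exact polyVal_sharp r z

theorem sharp_complexify (q : MvPolynomial (Fin 2) ℝ) : sharp (complexify q) = complexify q := by
  rw [sharp, complexify, MvPolynomial.map_map]
  congr 2
  ext x; simp

theorem wsum_star (f : Fin m → BddMeas (X : Set ℂ)) : wsum p (star f) = star (wsum p f) := by
  simp only [wsum, star_sum, star_mul', Pi.star_apply, ← polyFn_sharp, sharp_complexify]

theorem star_val (f : BddMeas (X : Set ℂ)) (z) : (star f).1 z = conj (f.1 z) := rfl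

theorem sharp_mul (r s : Poly) : sharp (r * s) = sharp r * sharp s := map_mul _ r s
theorem sharp_add (r s : Poly) : sharp (r + s) = sharp r + sharp s := map_add _ r s
theorem sharp_sharp (r : Poly) : sharp (sharp r) = r := by
  rw [sharp, sharp, MvPolynomial.map_map]; simp [MvPolynomial.map_id]

theorem MemNull.star {a : CalcAlg X p} (ha : a.MemNull) : (star a).MemNull := by
  rw [memNull_iff] at ha ⊢
  obtain ⟨h1, u, hu, h2⟩ := ha
  refine ⟨fun z hz => ?_, fun k => sharp (u k), ?_, fun j z hz => ?_⟩
  · rw [star_poly, star_fn, polyFn_sharp, wsum_star, ← star_add, star_val, h1 z hz, map_zero]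
  · rw [star_poly, hu, sharp, map_sum]
    refine Finset.sum_congr rfl fun k _ => ?_
    exact (sharp_mul _ _).trans (by rw [sharp_complexify])
  · rw [star_fn, Pi.star_apply, polyFn_sharp, ← star_add, star_val, h2 j z hz, map_zero]

theorem star_add' (a b : CalcAlg X p) : star (a + b) = star a + star b := by
  apply CalcAlg.ext
  · exact sharp_add _ _
  · funext j; simp
theorem star_star' (a : CalcAlg X p) : star (star a) = a := by
  apply CalcAlg.ext
  · exact sharp_sharp _
  · funext j; simp
theorem star_mul'' (a b : CalcAlg X p) : star (a * b) = star a * star b := by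
  apply CalcAlg.ext
  · exact sharp_mul _ _
  · funext j; simp only [star_fn, star_poly, mul_fn, Pi.star_apply, wsum_star, polyFn_sharp, star_mul', star_add]
theorem star_sub' (a b : CalcAlg X p) : star (a - b) = star a - star b := by
  rw [eq_sub_iff_add_eq, ← star_add', sub_add_cancel]

theorem commutator_mem (a b : CalcAlg X p) : a * b - b * a ∈ nullIdeal X p := by
  show (a * b - b * a).MemNull
  rw [memNull_iff]
  have e : polyFn X (a * b - b * a).poly + wsum p (a * b - b * a).fn = 0 := by
    have : wsum p (a * b - b * a).fn = wsum p (a * b).fn - wsum p (b * a).fn := by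
      rw [eq_sub_iff_add_eq, ← wsum_add]; simp
    rw [this, sub_poly, map_sub]
    have h1 := total_mul a b
    have h2 := total_mul b a
    linear_combination h1 - h2
  refine ⟨fun z hz => by rw [e]; rfl, 0, by simp [mul_comm], fun j z hz => ?_⟩
  have h5 := wsum_val_eq_zero b.fn z hz
  have h6 := wsum_val_eq_zero a.fn z hz
  have e2 : (a * b - b * a).fn j + polyFn X ((0 : Fin m → Poly) j) =
      a.fn j * wsum p b.fn - b.fn j * wsum p a.fn := by
    simp only [sub_fn, Pi.sub_apply, mul_fn, Pi.zero_apply, map_zero]; ring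
  rw [e2]
  show (a.fn j).1 z * (wsum p b.fn).1 z - (b.fn j).1 z * (wsum p a.fn).1 z = 0
  rw [h5, h6]; ring

/-- The commutative `*`-algebra `ℛ / 𝒩`. -/
abbrev QuotAlg (X : TopologicalSpace.Compacts ℂ) (p : Fin m → MvPolynomial (Fin 2) ℝ) : Type :=
  CalcAlg X p ⧸ nullIdeal X p

instance : CommRing (QuotAlg X p) where
  __ := Ideal.Quotient.ring (nullIdeal X p)
  mul_comm x y := by
    obtain ⟨a, rfl⟩ := Ideal.Quotient.mk_surjective x
    obtain ⟨b, rfl⟩ := Ideal.Quotient.mk_surjective y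
    rw [← map_mul, ← map_mul]
    exact Ideal.Quotient.eq.2 (commutator_mem a b)

instance : Star (QuotAlg X p) where
  star := Quotient.lift (fun a => Ideal.Quotient.mk (nullIdeal X p) (star a)) fun a b h => by
    refine Ideal.Quotient.eq.2 ?_
    rw [← star_sub']
    exact MemNull.star ((Submodule.quotientRel_def _).1 h)

theorem star_mk (a : CalcAlg X p) : star (Ideal.Quotient.mk (nullIdeal X p) a) =
    Ideal.Quotient.mk (nullIdeal X p) (star a) := rfl

instance : StarRing (QuotAlg X p) where
  star_involutive x := by
    obtain ⟨a, rfl⟩ := Ideal.Quotient.mk_surjective x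
    rw [star_mk, star_mk, star_star']
  star_mul x y := by
    obtain ⟨a, rfl⟩ := Ideal.Quotient.mk_surjective x
    obtain ⟨b, rfl⟩ := Ideal.Quotient.mk_surjective y
    rw [mul_comm (star _), ← map_mul, star_mk, star_mk, star_mk, star_mul'', map_mul]
  star_add x y := by
    obtain ⟨a, rfl⟩ := Ideal.Quotient.mk_surjective x
    obtain ⟨b, rfl⟩ := Ideal.Quotient.mk_surjective y
    rw [← map_add, star_mk, star_mk, star_mk, star_add', map_add]

instance : Algebra ℂ (QuotAlg X p) := Ideal.Quotient.algebra ℂ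

instance : StarModule ℂ (QuotAlg X p) where
  star_smul c x := by
    obtain ⟨a, rfl⟩ := Ideal.Quotient.mk_surjective x
    show Ideal.Quotient.mk (nullIdeal X p) (star (c • a)) =
      Ideal.Quotient.mk (nullIdeal X p) (star c • star a)
    congr 1
    apply CalcAlg.ext
    · simp [sharp, MvPolynomial.smul_eq_C_mul]
    · funext j; simp

end CalcAlg
end Algebra

/-! ## The functional calculus -/

section Calculus
variable {K : Type*} [NormedAddCommGroup K] [InnerProductSpace ℂ K] [CompleteSpace K] [KreinSpace K]
variable (N : K →L[ℂ] K) {m : ℕ} (p : Fin m → MvPolynomial (Fin 2) ℝ)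
  (hp : ∀ j, IsDefinitizing N (p j))

/-- The positive operator `p_j(A, B) = T_j T_j⁺`. -/
def posOp (j : Fin m) : PosOp K :=
  ⟨evalOp (complexify (p j)) (reOp N) (imOp N), (hp j).2⟩

/-- The positive operator `∑ p_k(A, B) = T T⁺`. -/
def posOpSum : PosOp K :=
  ⟨∑ k, evalOp (complexify (p k)) (reOp N) (imOp N), fun v => by
    simp only [form, sum_apply, map_sum, sum_inner]
    exact Finset.sum_nonneg fun k _ => (hp k).2 v⟩

/-- `σ(Θ(N))`. -/
def spec : TopologicalSpace.Compacts ℂ :=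
  ⟨spectrum ℂ (transport (posOpSum N p hp) N), spectrum.isCompact _⟩

/-- `Ψ(r, f_1, …, f_m) = r(A, B) + ∑ Ξ_k(∫_{σ(Θ_k(N))} f_k dE_k)`, where `E_k` is the spectral measure
of `Θ_k(N)`. As a function on `ℂ`, `f_k` is extended by zero from `σ(Θ(N)) ⊇ σ(Θ_k(N))`. -/
def Psi (a : CalcAlg (spec N p hp) p) : K →L[ℂ] K :=
  evalOp a.poly (reOp N) (imOp N) + ∑ k, lift (posOp N p hp k)
    (spectralIntegral (transport (posOp N p hp k) N) (Function.extend Subtype.val (a.fn k).1 0))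

end Calculus

end KreinCalculus
end

open KreinCalculus KreinCalculus.CalcAlg

noncomputable section
namespace KreinCalculus

open Filter Topology

section Polarization
variable {H : Type*} [NormedAddCommGroup H] [InnerProductSpace ℂ H]

theorem ext_inner_diag {S T : H →L[ℂ] H} (h : ∀ x, ⟪x, S x⟫_ℂ = ⟪x, T x⟫_ℂ) : S = T := by
  refine ContinuousLinearMap.coe_inj.1 ((ext_inner_map _ _).1 fun x => ?_)
  simp only [ContinuousLinearMap.coe_coe]
  rw [← inner_conj_symm, h, inner_conj_symm]

theorem inner_eq_polarization (S : H →L[ℂ] H) (x y : H) :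
    ⟪x, S y⟫_ℂ = (⟪x + y, S (x + y)⟫_ℂ - ⟪x - y, S (x - y)⟫_ℂ -
      Complex.I * ⟪x + Complex.I • y, S (x + Complex.I • y)⟫_ℂ +
      Complex.I * ⟪x - Complex.I • y, S (x - Complex.I • y)⟫_ℂ) / 4 := by
  simp only [map_add, map_sub, map_smul, inner_add_left, inner_add_right, inner_sub_left,
    inner_sub_right, inner_smul_left, inner_smul_right, Complex.conj_I]
  ring_nf
  simp only [Complex.I_sq]
  ring

end Polarization

section BorelCalculus
variable {H : Type*} [NormedAddCommGroup H] [InnerProductSpace ℂ H] [CompleteSpace H]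
variable {H' : Type*} [NormedAddCommGroup H'] [InnerProductSpace ℂ H'] [CompleteSpace H']

/-- An operator that intertwines two normal operators and their adjoints intertwines their
continuous functional calculi. -/
theorem comp_cfc_eq_cfc_comp {D : H →L[ℂ] H} {D' : H' →L[ℂ] H'} (hD : IsStarNormal D)
    (hD' : IsStarNormal D') {R : H →L[ℂ] H'} (h : R ∘L D = D' ∘L R)
    (hs : R ∘L ContinuousLinearMap.adjoint D = ContinuousLinearMap.adjoint D' ∘L R)
    {g : ℂ → ℂ} (hg : Continuous g) : R ∘L cfc g D = cfc g D' ∘L R := by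
  set s : Set ℂ := spectrum ℂ D ∪ spectrum ℂ D' with hsdef
  have : CompactSpace s :=
    isCompact_iff_compactSpace.1 ((spectrum.isCompact D).union (spectrum.isCompact D'))
  have h1 : spectrum ℂ D ⊆ s := Set.subset_union_left
  have h2 : spectrum ℂ D' ⊆ s := Set.subset_union_right
  have key : ∀ f : C(s, ℂ), R ∘L cfcHomSuperset hD h1 f = cfcHomSuperset hD' h2 f ∘L R := by
    intro f
    induction f using ContinuousMap.induction_on_of_compact with
    | const r =>
      have e : ContinuousMap.const s r = algebraMap ℂ C(s, ℂ) r := rfl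
      rw [e, AlgHomClass.commutes, AlgHomClass.commutes]
      ext x; simp [Algebra.algebraMap_eq_smul_one]
    | id => rw [cfcHomSuperset_id, cfcHomSuperset_id, h]
    | star_id =>
      rw [map_star, map_star, cfcHomSuperset_id, cfcHomSuperset_id]
      exact hs
    | add f g hf hg =>
      rw [map_add, map_add, ContinuousLinearMap.comp_add, ContinuousLinearMap.add_comp, hf, hg]
    | mul f g hf hg =>
      rw [map_mul, map_mul, ContinuousLinearMap.mul_def, ContinuousLinearMap.mul_def,
        ← ContinuousLinearMap.comp_assoc, hf, ContinuousLinearMap.comp_assoc, hg,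
        ContinuousLinearMap.comp_assoc]
    | frequently f hf =>
      have c1 := cfcHomSuperset_continuous hD h1
      have c2 := cfcHomSuperset_continuous hD' h2
      exact hf.mem_of_closed <| isClosed_eq (continuous_const.clm_comp c1)
        (c2.clm_comp continuous_const)
  have e1 : cfc g D = cfcHomSuperset hD h1 ⟨_, hg.continuousOn.domRestrict⟩ := by
    rw [cfcHomSuperset_apply, cfc_apply g D hD hg.continuousOn]; rfl
  have e2 : cfc g D' = cfcHomSuperset hD' h2 ⟨_, hg.continuousOn.domRestrict⟩ := by
    rw [cfcHomSuperset_apply, cfc_apply g D' hD' hg.continuousOn]; rfl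
  rw [e1, e2, key]

theorem scalarMeasure_compl_spectrum (D : H →L[ℂ] H) (x : H) :
    scalarMeasure D x (spectrum ℂ D)ᶜ = 0 := by
  rw [(spectrum.isClosed D).isOpen_compl.measure_eq_iSup_isCompact]
  refine le_antisymm (iSup_le fun L => iSup_le fun hLs => iSup_le fun hL => ?_) zero_le
  obtain ⟨f, hf1, hf0, hfc, hf⟩ := exists_continuous_one_zero_of_isCompact hL
    (spectrum.isClosed (𝕜 := ℂ) D) (Set.disjoint_left.2 fun z hz hz' => hLs hz hz')
  refine (RealRMK.rieszMeasure_le_of_eq_one (f := ⟨f, hfc⟩) _ (fun z => (hf z).1) hL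
    (fun z hz => hf1 hz)).trans ?_
  rw [calcFunctional_apply]
  have : cfc (fun z => ((f z : ℝ) : ℂ)) D = cfc (fun _ => (0 : ℂ)) D :=
    cfc_congr fun z hz => by simpa using hf0 hz
  rw [show (fun z => (((⟨f, hfc⟩ : C_c(ℂ, ℝ)) z : ℝ) : ℂ)) = fun z => ((f z : ℝ) : ℂ) from rfl,
    this]
  simp

/-- Boundedness and Borel measurability of a function on `ℂ`. -/
structure IsBddBorel (f : ℂ → ℂ) : Prop where
  measurable : Measurable f
  bounded : ∃ C : ℝ, ∀ z, ‖f z‖ ≤ C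

theorem IsBddBorel.mul {f g : ℂ → ℂ} (hf : IsBddBorel f) (hg : IsBddBorel g) :
    IsBddBorel fun z => f z * g z := by
  obtain ⟨C, hC⟩ := hf.bounded
  obtain ⟨C', hC'⟩ := hg.bounded
  refine ⟨hf.measurable.mul hg.measurable, C * C', fun z => ?_⟩
  rw [norm_mul]
  exact mul_le_mul (hC z) (hC' z) (norm_nonneg _) ((norm_nonneg _).trans (hC z))

theorem IsBddBorel.of_hasCompactSupport {g : ℂ → ℂ} (hg : Continuous g)
    (hc : HasCompactSupport g) : IsBddBorel g :=
  ⟨hg.measurable, hg.bounded_above_of_compact_support hc⟩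

theorem IsBddBorel.one : IsBddBorel fun _ => 1 := ⟨measurable_const, 1, fun _ => by simp⟩

theorem IsBddBorel.integrable {f : ℂ → ℂ} (hf : IsBddBorel f) (μ : Measure ℂ)
    [IsFiniteMeasure μ] : Integrable f μ := by
  obtain ⟨C, hC⟩ := hf.bounded
  exact Integrable.of_bound hf.measurable.aestronglyMeasurable C (Filter.Eventually.of_forall hC)

theorem inner_spectralIntegral_eq_integral (D : H →L[ℂ] H) {f : ℂ → ℂ} (hf : IsBddBorel f)
    (x : H) : ⟪x, spectralIntegral D f x⟫_ℂ = ∫ z, f z ∂(scalarMeasure D x) := by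
  rw [inner_spectralIntegral D f hf.measurable hf.bounded, Measure.restrict_eq_self_of_ae_mem]
  exact mem_ae_iff.2 (scalarMeasure_compl_spectrum D x)

theorem spectralIntegral_congr (D : H →L[ℂ] H) {f g : ℂ → ℂ} (hf : IsBddBorel f)
    (hg : IsBddBorel g) (h : Set.EqOn f g (spectrum ℂ D)) :
    spectralIntegral D f = spectralIntegral D g := by
  refine ext_inner_diag fun x => ?_
  rw [inner_spectralIntegral D f hf.measurable hf.bounded,
    inner_spectralIntegral D g hg.measurable hg.bounded]
  exact setIntegral_congr_fun (spectrum.isClosed D).measurableSet h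

theorem spectralIntegral_eq_cfc (D : H →L[ℂ] H) {g : ℂ → ℂ} (hg : Continuous g)
    (hc : HasCompactSupport g) : spectralIntegral D g = cfc g D :=
  ext_inner_diag fun x => by
    rw [inner_spectralIntegral_eq_integral D (.of_hasCompactSupport hg hc),
      integral_scalarMeasure D x g hg hc]

theorem exists_tendsto_integral_mul (ν : Measure ℂ) [IsFiniteMeasure ν] {f : ℂ → ℂ}
    (hf : IsBddBorel f) :
    ∃ g : ℕ → ℂ → ℂ, (∀ n, Continuous (g n) ∧ HasCompactSupport (g n)) ∧
      ∀ μ ≤ ν, ∀ h, IsBddBorel h →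
        Tendsto (fun n => ∫ z, g n z * h z ∂μ) atTop (𝓝 (∫ z, f z * h z ∂μ)) := by
  choose g hgc hgi hg hgint using fun n : ℕ =>
    (hf.integrable ν).exists_hasCompactSupport_integral_sub_le (ε := 1 / ((n : ℝ) + 1))
      (by positivity)
  refine ⟨g, fun n => ⟨hg n, hgc n⟩, fun μ hμ h hh => ?_⟩
  have : IsFiniteMeasure μ := isFiniteMeasure_of_le ν hμ
  obtain ⟨C, hC⟩ := hh.bounded
  have hC0 : 0 ≤ C := (norm_nonneg _).trans (hC 0)
  rw [tendsto_iff_norm_sub_tendsto_zero]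
  have h0 : Tendsto (fun n : ℕ => C * (1 / ((n : ℝ) + 1))) atTop (𝓝 0) := by
    simpa using tendsto_one_div_add_atTop_nhds_zero_nat.const_mul C
  refine squeeze_zero (fun _ => norm_nonneg _) (fun n => ?_) h0
  have hgb := IsBddBorel.of_hasCompactSupport (hg n) (hgc n)
  rw [← integral_sub ((hgb.mul hh).integrable μ) ((hf.mul hh).integrable μ)]
  calc ‖∫ z, g n z * h z - f z * h z ∂μ‖ ≤ ∫ z, ‖g n z * h z - f z * h z‖ ∂μ :=
        norm_integral_le_integral_norm _
    _ ≤ ∫ z, C * ‖f z - g n z‖ ∂μ := by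
        refine integral_mono (((hgb.mul hh).integrable μ).sub ((hf.mul hh).integrable μ)).norm
          (((hf.integrable μ).sub (hgb.integrable μ)).norm.const_mul C) fun z => ?_
        simp only
        rw [← sub_mul, norm_mul, mul_comm, norm_sub_rev]
        exact mul_le_mul_of_nonneg_right (hC z) (norm_nonneg _)
    _ = C * ∫ z, ‖f z - g n z‖ ∂μ := integral_const_mul _ _
    _ ≤ C * (1 / ((n : ℝ) + 1)) := by
        refine mul_le_mul_of_nonneg_left (le_trans ?_ (hgi n)) hC0
        exact integral_mono_measure hμ (Filter.Eventually.of_forall fun z => norm_nonneg _)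
          ((hf.integrable ν).sub (hgint n)).norm

/-- A finite measure dominating the four scalar measures that occur in the polarization identity
for `(x, y)`. -/
def polarMeasure (D : H →L[ℂ] H) (x y : H) : Measure ℂ :=
  scalarMeasure D (x + y) + scalarMeasure D (x - y) + scalarMeasure D (x + Complex.I • y) +
    scalarMeasure D (x - Complex.I • y)

instance (D : H →L[ℂ] H) (x y : H) : IsFiniteMeasure (polarMeasure D x y) := by
  unfold polarMeasure; infer_instance

theorem tendsto_inner_spectralIntegral (D : H →L[ℂ] H) (x y : H) {f : ℂ → ℂ} {g : ℕ → ℂ → ℂ}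
    (hf : IsBddBorel f) (hg : ∀ n, IsBddBorel (g n))
    (h : ∀ μ ≤ polarMeasure D x y, Tendsto (fun n => ∫ z, g n z ∂μ) atTop (𝓝 (∫ z, f z ∂μ))) :
    Tendsto (fun n => ⟪x, spectralIntegral D (g n) y⟫_ℂ) atTop
      (𝓝 ⟪x, spectralIntegral D f y⟫_ℂ) := by
  have key : ∀ u, scalarMeasure D u ≤ polarMeasure D x y →
      Tendsto (fun n => ⟪u, spectralIntegral D (g n) u⟫_ℂ) atTop
        (𝓝 ⟪u, spectralIntegral D f u⟫_ℂ) := fun u hu => by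
    simp only [inner_spectralIntegral_eq_integral D hf,
      inner_spectralIntegral_eq_integral D (hg _)]
    exact h _ hu
  have h1 := key (x + y) (by
    unfold polarMeasure
    exact (Measure.le_add_right le_rfl).trans ((Measure.le_add_right le_rfl).trans
      (Measure.le_add_right le_rfl)))
  have h2 := key (x - y) (by
    unfold polarMeasure
    exact (Measure.le_add_left le_rfl).trans ((Measure.le_add_right le_rfl).trans
      (Measure.le_add_right le_rfl)))
  have h3 := key (x + Complex.I • y) (by
    unfold polarMeasure
    exact (Measure.le_add_left le_rfl).trans (Measure.le_add_right le_rfl))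
  have h4 := key (x - Complex.I • y) (by
    unfold polarMeasure
    exact Measure.le_add_left le_rfl)
  rw [inner_eq_polarization]
  simp only [inner_eq_polarization _ x y]
  exact (((h1.sub h2).sub (h3.const_mul _)).add (h4.const_mul _)).div_const 4

/-- An operator that intertwines two normal operators and their adjoints intertwines their Borel
functional calculi. -/
theorem comp_spectralIntegral {D : H →L[ℂ] H} {D' : H' →L[ℂ] H'} (hD : IsStarNormal D)
    (hD' : IsStarNormal D') {R : H →L[ℂ] H'} (h : R ∘L D = D' ∘L R)
    (hs : R ∘L ContinuousLinearMap.adjoint D = ContinuousLinearMap.adjoint D' ∘L R)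
    {f : ℂ → ℂ} (hf : IsBddBorel f) :
    R ∘L spectralIntegral D f = spectralIntegral D' f ∘L R := by
  ext x
  refine ext_inner_left ℂ fun y => ?_
  simp only [ContinuousLinearMap.comp_apply]
  rw [← ContinuousLinearMap.adjoint_inner_left]
  obtain ⟨g, hg, hlim⟩ := exists_tendsto_integral_mul
    (polarMeasure D (ContinuousLinearMap.adjoint R y) x + polarMeasure D' y (R x)) hf
  have hgb : ∀ n, IsBddBorel (g n) := fun n => .of_hasCompactSupport (hg n).1 (hg n).2
  have hlim' : ∀ μ ≤ polarMeasure D (ContinuousLinearMap.adjoint R y) x + polarMeasure D' y (R x),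
      Tendsto (fun n => ∫ z, g n z ∂μ) atTop (𝓝 (∫ z, f z ∂μ)) := fun μ hμ => by
    simpa using hlim μ hμ _ .one
  have h1 := tendsto_inner_spectralIntegral D (ContinuousLinearMap.adjoint R y) x hf hgb
    fun μ hμ => hlim' μ (hμ.trans (Measure.le_add_right le_rfl))
  have h2 := tendsto_inner_spectralIntegral D' y (R x) hf hgb
    fun μ hμ => hlim' μ (hμ.trans (Measure.le_add_left le_rfl))
  refine tendsto_nhds_unique h1 (h2.congr fun n => ?_)
  rw [ContinuousLinearMap.adjoint_inner_left, spectralIntegral_eq_cfc D (hg n).1 (hg n).2,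
    spectralIntegral_eq_cfc D' (hg n).1 (hg n).2]
  exact congrArg (fun v => ⟪y, v⟫_ℂ)
    (DFunLike.congr_fun (comp_cfc_eq_cfc_comp hD hD' h hs (hg n).1) x).symm

theorem spectralIntegral_star (D : H →L[ℂ] H) {f : ℂ → ℂ} (hf : IsBddBorel f)
    (hf' : IsBddBorel fun z => conj (f z)) :
    spectralIntegral D (fun z => conj (f z)) =
      ContinuousLinearMap.adjoint (spectralIntegral D f) :=
  ext_inner_diag fun x => by
    rw [inner_spectralIntegral_eq_integral D hf', ContinuousLinearMap.adjoint_inner_right,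
      ← inner_conj_symm, inner_spectralIntegral_eq_integral D hf, integral_conj]

theorem spectralIntegral_add (D : H →L[ℂ] H) {f g : ℂ → ℂ} (hf : IsBddBorel f)
    (hg : IsBddBorel g) (hfg : IsBddBorel fun z => f z + g z) :
    spectralIntegral D (fun z => f z + g z) = spectralIntegral D f + spectralIntegral D g :=
  ext_inner_diag fun x => by
    rw [inner_spectralIntegral_eq_integral D hfg,
      integral_add (hf.integrable _) (hg.integrable _), add_apply, inner_add_right,
      inner_spectralIntegral_eq_integral D hf, inner_spectralIntegral_eq_integral D hg]

theorem spectralIntegral_smul (D : H →L[ℂ] H) (c : ℂ) {f : ℂ → ℂ} (hf : IsBddBorel f)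
    (hcf : IsBddBorel fun z => c * f z) :
    spectralIntegral D (fun z => c * f z) = c • spectralIntegral D f :=
  ext_inner_diag fun x => by
    rw [inner_spectralIntegral_eq_integral D hcf, integral_const_mul, smul_apply,
      inner_smul_right, inner_spectralIntegral_eq_integral D hf]

theorem spectralIntegral_mul_continuous (D : H →L[ℂ] H) {f g : ℂ → ℂ}
    (hf : IsBddBorel f) (hg : Continuous g) (hc : HasCompactSupport g) :
    spectralIntegral D (fun z => f z * g z) = spectralIntegral D f * spectralIntegral D g := by
  have hgb := IsBddBorel.of_hasCompactSupport hg hc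
  ext y
  refine ext_inner_left ℂ fun x => ?_
  obtain ⟨k, hk, hlim⟩ := exists_tendsto_integral_mul
    (polarMeasure D x y + polarMeasure D x (spectralIntegral D g y)) hf
  have hkb : ∀ n, IsBddBorel (k n) := fun n => .of_hasCompactSupport (hk n).1 (hk n).2
  have h1 := tendsto_inner_spectralIntegral D x y (hf.mul hgb) (fun n => (hkb n).mul hgb)
    fun μ hμ => hlim μ (hμ.trans (Measure.le_add_right le_rfl)) g hgb
  have h2 := tendsto_inner_spectralIntegral D x (spectralIntegral D g y) hf hkb
    fun μ hμ => by simpa using hlim μ (hμ.trans (Measure.le_add_left le_rfl)) _ .one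
  refine tendsto_nhds_unique h1 (h2.congr fun n => ?_)
  have hkg : HasCompactSupport fun z => k n z * g z := hc.mul_left (f := k n)
  rw [spectralIntegral_eq_cfc D (g := fun z => k n z * g z) ((hk n).1.mul hg) hkg,
    spectralIntegral_eq_cfc D (hk n).1 (hk n).2, spectralIntegral_eq_cfc D hg hc,
    cfc_mul (k n) g D (hk n).1.continuousOn hg.continuousOn]
  rfl

theorem spectralIntegral_mul (D : H →L[ℂ] H) {f g : ℂ → ℂ}
    (hf : IsBddBorel f) (hg : IsBddBorel g) :
    spectralIntegral D (fun z => f z * g z) = spectralIntegral D f * spectralIntegral D g := by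
  ext y
  refine ext_inner_left ℂ fun x => ?_
  set x' := ContinuousLinearMap.adjoint (spectralIntegral D f) x with hx'
  obtain ⟨k, hk, hlim⟩ := exists_tendsto_integral_mul
    (polarMeasure D x y + polarMeasure D x' y) hg
  have hkb : ∀ n, IsBddBorel (k n) := fun n => .of_hasCompactSupport (hk n).1 (hk n).2
  have h1 := tendsto_inner_spectralIntegral D x y (hf.mul hg) (fun n => hf.mul (hkb n))
    fun μ hμ => by
      simpa only [mul_comm (f _)] using hlim μ (hμ.trans (Measure.le_add_right le_rfl)) f hf
  have h2 := tendsto_inner_spectralIntegral D x' y hg hkb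
    fun μ hμ => by simpa using hlim μ (hμ.trans (Measure.le_add_left le_rfl)) _ .one
  simp only [hx', ContinuousLinearMap.adjoint_inner_left] at h2
  refine tendsto_nhds_unique h1 (h2.congr fun n => ?_)
  rw [spectralIntegral_mul_continuous D hf (hk n).1 (hk n).2]
  rfl

theorem norm_sq_spectralIntegral (D : H →L[ℂ] H) {f : ℂ → ℂ} (hf : IsBddBorel f) (x : H) :
    ‖spectralIntegral D f x‖ ^ 2 = ∫ z, ‖f z‖ ^ 2 ∂(scalarMeasure D x) := by
  have hf' : IsBddBorel fun z => conj (f z) := by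
    obtain ⟨C, hC⟩ := hf.bounded
    exact ⟨Complex.continuous_conj.measurable.comp hf.measurable, C, fun z => by simpa using hC z⟩
  have h : ((‖spectralIntegral D f x‖ ^ 2 : ℝ) : ℂ) =
      ((∫ z, ‖f z‖ ^ 2 ∂(scalarMeasure D x) : ℝ) : ℂ) := by
    rw [← integral_complex_ofReal]
    have e : ∀ z, ((‖f z‖ ^ 2 : ℝ) : ℂ) = conj (f z) * f z := fun z => by
      rw [mul_comm, Complex.mul_conj, Complex.normSq_eq_norm_sq]
    simp only [e]
    rw [← inner_spectralIntegral_eq_integral D (hf'.mul hf), spectralIntegral_mul D hf' hf,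
      spectralIntegral_star D hf hf', mul_apply_eq_comp,
      ContinuousLinearMap.adjoint_inner_right, inner_self_eq_norm_sq_to_K]
    simp
  exact_mod_cast h

theorem spectralIntegral_apply_eq_zero_iff (D : H →L[ℂ] H) {f : ℂ → ℂ} (hf : IsBddBorel f)
    (x : H) : spectralIntegral D f x = 0 ↔ f =ᵐ[scalarMeasure D x] 0 := by
  have hint : Integrable (fun z => ‖f z‖ ^ 2) (scalarMeasure D x) := by
    simpa [pow_two] using ((hf.mul hf).integrable (scalarMeasure D x)).norm
  rw [← norm_eq_zero, ← sq_eq_zero_iff, norm_sq_spectralIntegral D hf,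
    integral_eq_zero_iff_of_nonneg (fun z => by positivity) hint]
  constructor <;> intro h <;> filter_upwards [h] with z hz
  · simpa using hz
  · simpa using hz

end BorelCalculus

section CalculusHom
variable {H : Type*} [NormedAddCommGroup H] [InnerProductSpace ℂ H] [CompleteSpace H]
variable {H' : Type*} [NormedAddCommGroup H'] [InnerProductSpace ℂ H'] [CompleteSpace H']
variable {X : TopologicalSpace.Compacts ℂ}

/-- The extension by zero of a bounded Borel function on `X`. -/
abbrev zeroExtend (f : BddMeas (X : Set ℂ)) : ℂ → ℂ := Function.extend Subtype.val f.1 0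

theorem zeroExtend_of_mem (f : BddMeas (X : Set ℂ)) {z : ℂ} (hz : z ∈ (X : Set ℂ)) :
    zeroExtend f z = f.1 ⟨z, hz⟩ :=
  Subtype.val_injective.extend_apply f.1 0 (⟨z, hz⟩ : (X : Set ℂ))

theorem zeroExtend_of_notMem (f : BddMeas (X : Set ℂ)) {z : ℂ} (hz : z ∉ (X : Set ℂ)) :
    zeroExtend f z = 0 :=
  Function.extend_apply' _ _ _ fun ⟨w, hw⟩ => hz (hw ▸ w.2)

theorem isBddBorel_zeroExtend (f : BddMeas (X : Set ℂ)) : IsBddBorel (zeroExtend f) := by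
  obtain ⟨hf, C, hC⟩ := f.2
  refine ⟨(MeasurableEmbedding.subtype_coe X.isCompact.measurableSet).measurable_extend hf
    measurable_const, max C 0, fun z => ?_⟩
  by_cases hz : z ∈ (X : Set ℂ)
  · rw [zeroExtend_of_mem f hz]; exact (hC _).trans (le_max_left _ _)
  · rw [zeroExtend_of_notMem f hz]; simp

theorem zeroExtend_mul (f g : BddMeas (X : Set ℂ)) :
    zeroExtend (f * g) = fun z => zeroExtend f z * zeroExtend g z := by
  funext z
  by_cases hz : z ∈ (X : Set ℂ)
  · simp only [zeroExtend_of_mem _ hz]; rfl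
  · simp only [zeroExtend_of_notMem _ hz, mul_zero]

theorem zeroExtend_add (f g : BddMeas (X : Set ℂ)) :
    zeroExtend (f + g) = fun z => zeroExtend f z + zeroExtend g z := by
  funext z
  by_cases hz : z ∈ (X : Set ℂ)
  · simp only [zeroExtend_of_mem _ hz]; rfl
  · simp only [zeroExtend_of_notMem _ hz, add_zero]

theorem zeroExtend_smul (c : ℂ) (f : BddMeas (X : Set ℂ)) :
    zeroExtend (c • f) = fun z => c * zeroExtend f z := by
  funext z
  by_cases hz : z ∈ (X : Set ℂ)
  · simp only [zeroExtend_of_mem _ hz]; rfl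
  · simp only [zeroExtend_of_notMem _ hz, mul_zero]

theorem zeroExtend_star (f : BddMeas (X : Set ℂ)) :
    zeroExtend (star f) = fun z => conj (zeroExtend f z) := by
  funext z
  by_cases hz : z ∈ (X : Set ℂ)
  · simp only [zeroExtend_of_mem _ hz]; rfl
  · simp only [zeroExtend_of_notMem _ hz, map_zero]

theorem spectralIntegral_zeroExtend_eq_cfc (D : H →L[ℂ] H) (hX : spectrum ℂ D ⊆ X)
    (f : BddMeas (X : Set ℂ)) {g : ℂ → ℂ} (hg : Continuous g)
    (h : ∀ z : (X : Set ℂ), f.1 z = g z) : spectralIntegral D (zeroExtend f) = cfc g D := by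
  obtain ⟨b, hb1, -, hbc, -⟩ := exists_continuous_one_zero_of_isCompact X.isCompact isClosed_empty
    (Set.disjoint_empty _)
  have hbg : Continuous fun z => ((b z : ℝ) : ℂ) * g z :=
    (Complex.continuous_ofReal.comp b.continuous).mul hg
  have hc : HasCompactSupport fun z => ((b z : ℝ) : ℂ) * g z :=
    (hbc.comp_left (g := Complex.ofReal) rfl).mul_right
  rw [spectralIntegral_congr D (isBddBorel_zeroExtend f) (.of_hasCompactSupport hbg hc)
    fun z hz => ?_, spectralIntegral_eq_cfc D hbg hc]
  · exact cfc_congr fun z hz => by simp [hb1 (hX hz)]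
  · rw [zeroExtend_of_mem f (hX hz), h]
    simp [hb1 (hX hz)]

/-- The Borel functional calculus `f ↦ ∫ f dE` of a normal operator with spectrum in `X`. -/
def borelCalc (D : H →L[ℂ] H) (hD : IsStarNormal D) (hX : spectrum ℂ D ⊆ X) :
    BddMeas (X : Set ℂ) →⋆ₐ[ℂ] (H →L[ℂ] H) where
  toFun f := spectralIntegral D (zeroExtend f)
  map_one' := by
    rw [spectralIntegral_zeroExtend_eq_cfc D hX 1 (g := fun _ => 1) continuous_const fun _ => rfl]
    exact cfc_const_one ℂ D
  map_mul' f g := by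
    rw [zeroExtend_mul,
      spectralIntegral_mul D (isBddBorel_zeroExtend f) (isBddBorel_zeroExtend g)]
  map_zero' := by
    rw [spectralIntegral_zeroExtend_eq_cfc D hX 0 (g := fun _ => 0) continuous_const fun _ => rfl]
    exact cfc_const_zero ℂ D
  map_add' f g := by
    have h := isBddBorel_zeroExtend (f + g)
    rw [zeroExtend_add] at h ⊢
    exact spectralIntegral_add D (isBddBorel_zeroExtend f) (isBddBorel_zeroExtend g) h
  commutes' c := by
    have h := isBddBorel_zeroExtend (c • (1 : BddMeas (X : Set ℂ)))
    rw [zeroExtend_smul] at h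
    rw [Algebra.algebraMap_eq_smul_one, Algebra.algebraMap_eq_smul_one, zeroExtend_smul,
      spectralIntegral_smul D c (isBddBorel_zeroExtend 1) h,
      spectralIntegral_zeroExtend_eq_cfc D hX 1 (g := fun _ => 1) continuous_const fun _ => rfl,
      cfc_const_one ℂ D]
  map_star' f := by
    have h := isBddBorel_zeroExtend (star f)
    rw [zeroExtend_star] at h ⊢
    exact spectralIntegral_star D (isBddBorel_zeroExtend f) h

theorem borelCalc_apply (D : H →L[ℂ] H) (hD : IsStarNormal D) (hX : spectrum ℂ D ⊆ X)
    (f : BddMeas (X : Set ℂ)) : borelCalc D hD hX f = spectralIntegral D (zeroExtend f) := rfl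

theorem inner_borelCalc {D : H →L[ℂ] H} (hD : IsStarNormal D) (hX : spectrum ℂ D ⊆ X)
    (f : BddMeas (X : Set ℂ)) (x y : H) :
    ⟪x, borelCalc D hD hX f y⟫_ℂ = ⟪borelCalc D hD hX (star f) x, y⟫_ℂ := by
  rw [map_star, ContinuousLinearMap.star_eq_adjoint, ContinuousLinearMap.adjoint_inner_left]

theorem comp_borelCalc {D : H →L[ℂ] H} {D' : H' →L[ℂ] H'} (hD : IsStarNormal D)
    (hD' : IsStarNormal D') (hX : spectrum ℂ D ⊆ X) (hX' : spectrum ℂ D' ⊆ X) {R : H →L[ℂ] H'}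
    (h : R ∘L D = D' ∘L R)
    (hs : R ∘L ContinuousLinearMap.adjoint D = ContinuousLinearMap.adjoint D' ∘L R)
    (f : BddMeas (X : Set ℂ)) : R ∘L borelCalc D hD hX f = borelCalc D' hD' hX' f ∘L R :=
  comp_spectralIntegral hD hD' h hs (isBddBorel_zeroExtend f)

/-- The common kernel of `∫ a_k dE` is annihilated by `∫ g dE` if `g` vanishes on the common zeros
of the `a_k`. -/
theorem borelCalc_apply_eq_zero {ι : Type*} [Countable ι] {D : H →L[ℂ] H} (hD : IsStarNormal D)
    (hX : spectrum ℂ D ⊆ X) (a : ι → BddMeas (X : Set ℂ)) (g : BddMeas (X : Set ℂ)) {x : H}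
    (ha : ∀ k, borelCalc D hD hX (a k) x = 0)
    (hg : ∀ z, (∀ k, (a k).1 z = 0) → g.1 z = 0) : borelCalc D hD hX g x = 0 := by
  simp only [borelCalc_apply,
    spectralIntegral_apply_eq_zero_iff D (isBddBorel_zeroExtend _)] at ha ⊢
  filter_upwards [eventually_countable_forall.2 ha] with z hz
  by_cases hzX : z ∈ (X : Set ℂ)
  · simp only [zeroExtend_of_mem _ hzX, Pi.zero_apply] at hz ⊢
    exact hg _ hz
  · exact zeroExtend_of_notMem g hzX

theorem polyFn_X_zero_add_I_mul (z : (X : Set ℂ)) :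
    (polyFn X (MvPolynomial.X 0) + Complex.I • polyFn X (MvPolynomial.X 1)).1 z = (z : ℂ) := by
  show polyVal (MvPolynomial.X 0) z + Complex.I * polyVal (MvPolynomial.X 1) z = z
  simp only [polyVal, MvPolynomial.eval_X]
  rw [mul_comm]
  exact Complex.re_add_im _

theorem star_polyFn_X (i : Fin 2) :
    star (polyFn X (MvPolynomial.X i)) = polyFn X (MvPolynomial.X i) := by
  rw [← CalcAlg.polyFn_sharp, sharp, MvPolynomial.map_X]

theorem borelCalc_X_zero_add (D : H →L[ℂ] H) (hD : IsStarNormal D) (hX : spectrum ℂ D ⊆ X) :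
    borelCalc D hD hX (polyFn X (MvPolynomial.X 0)) +
      Complex.I • borelCalc D hD hX (polyFn X (MvPolynomial.X 1)) = D := by
  rw [← map_smul, ← map_add, borelCalc_apply, spectralIntegral_zeroExtend_eq_cfc D hX _
    continuous_id polyFn_X_zero_add_I_mul]
  exact cfc_id ℂ D

theorem borelCalc_X_zero_sub (D : H →L[ℂ] H) (hD : IsStarNormal D) (hX : spectrum ℂ D ⊆ X) :
    borelCalc D hD hX (polyFn X (MvPolynomial.X 0)) -
      Complex.I • borelCalc D hD hX (polyFn X (MvPolynomial.X 1)) =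
      ContinuousLinearMap.adjoint D := by
  conv_rhs => rw [← borelCalc_X_zero_add D hD hX]
  rw [← ContinuousLinearMap.star_eq_adjoint, star_add, star_smul,
    ← map_star (borelCalc D hD hX), ← map_star (borelCalc D hD hX), star_polyFn_X, star_polyFn_X]
  simp [sub_eq_add_neg]

theorem borelCalc_X_zero (D : H →L[ℂ] H) (hD : IsStarNormal D) (hX : spectrum ℂ D ⊆ X) :
    borelCalc D hD hX (polyFn X (MvPolynomial.X 0)) =
      (1 / 2 : ℂ) • (D + ContinuousLinearMap.adjoint D) := by
  conv_rhs => rw [← borelCalc_X_zero_sub D hD hX]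
  nth_rewrite 2 [← borelCalc_X_zero_add D hD hX]
  module

theorem borelCalc_X_one (D : H →L[ℂ] H) (hD : IsStarNormal D) (hX : spectrum ℂ D ⊆ X) :
    borelCalc D hD hX (polyFn X (MvPolynomial.X 1)) =
      (1 / (2 * Complex.I)) • (D - ContinuousLinearMap.adjoint D) := by
  conv_rhs => rw [← borelCalc_X_zero_sub D hD hX]
  nth_rewrite 2 [← borelCalc_X_zero_add D hD hX]
  rw [add_sub_sub_cancel, ← two_smul ℂ, smul_smul, smul_smul,
    mul_assoc, one_div_mul_cancel (by simp), one_smul]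

/-- If an injective operator intertwines two normal operators and their adjoints, the spectrum of
the first is contained in the spectrum of the second. -/
theorem spectrum_subset_of_intertwine {D : H →L[ℂ] H} {D' : H' →L[ℂ] H'} (hD : IsStarNormal D)
    (hD' : IsStarNormal D') {R : H →L[ℂ] H'} (hR : Function.Injective R) (h : R ∘L D = D' ∘L R)
    (hs : R ∘L ContinuousLinearMap.adjoint D = ContinuousLinearMap.adjoint D' ∘L R) :
    spectrum ℂ D ⊆ spectrum ℂ D' := by
  intro z hz
  by_contra hz'
  obtain ⟨b, hb1, hb0, -, -⟩ := exists_continuous_one_zero_of_isCompact (isCompact_singleton (x := z))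
    (spectrum.isClosed (𝕜 := ℂ) D') (Set.disjoint_singleton_left.2 hz')
  have hb : Continuous fun w => ((b w : ℝ) : ℂ) := Complex.continuous_ofReal.comp b.continuous
  have h1 : cfc (fun w => ((b w : ℝ) : ℂ)) D' = 0 := by
    rw [← cfc_const_zero ℂ D']
    exact cfc_congr fun w hw => by simpa using hb0 hw
  have h2 := comp_cfc_eq_cfc_comp hD hD' h hs hb
  have h3 : cfc (fun w => ((b w : ℝ) : ℂ)) D = cfc (fun _ => (0 : ℂ)) D := by
    rw [cfc_const_zero]
    ext x
    apply hR
    have := DFunLike.congr_fun h2 x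
    simpa [h1] using this
  have h4 := (cfc_eq_cfc_iff_eqOn hD hb.continuousOn continuousOn_const).1 h3 hz
  have h5 := hb1 (Set.mem_singleton z)
  simp_all

end CalculusHom

section KreinAdjoint
variable {K : Type*} [NormedAddCommGroup K] [InnerProductSpace ℂ K] [CompleteSpace K] [KreinSpace K]

theorem kadj_add (C C' : K →L[ℂ] K) : kadj (C + C') = kadj C + kadj C' := by
  simp [kadj, ContinuousLinearMap.add_comp, ContinuousLinearMap.comp_add]

theorem kadj_smul (c : ℂ) (C : K →L[ℂ] K) : kadj (c • C) = conj c • kadj C := by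
  have : ContinuousLinearMap.adjoint (c • C) = conj c • ContinuousLinearMap.adjoint C :=
    star_smul c C
  ext x; simp [kadj, this]

theorem kadj_zero : kadj (0 : K →L[ℂ] K) = 0 := by simp [kadj]

theorem kadj_sum {ι : Type*} (s : Finset ι) (C : ι → K →L[ℂ] K) :
    kadj (∑ k ∈ s, C k) = ∑ k ∈ s, kadj (C k) := by
  classical
  induction s using Finset.induction_on with
  | empty => simp [kadj_zero]
  | insert a s ha ih => rw [Finset.sum_insert ha, Finset.sum_insert ha, kadj_add, ih]

theorem kadj_one : kadj (1 : K →L[ℂ] K) = 1 := by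
  ext x
  have : ContinuousLinearMap.adjoint (1 : K →L[ℂ] K) = 1 := star_one _
  simp [kadj, this, J_J]

theorem kadj_mul (C C' : K →L[ℂ] K) : kadj (C * C') = kadj C' * kadj C := by
  ext x
  have : ContinuousLinearMap.adjoint (C * C') =
    ContinuousLinearMap.adjoint C' * ContinuousLinearMap.adjoint C := star_mul C C'
  simp [kadj, this, J_J]

theorem kadj_kadj (C : K →L[ℂ] K) : kadj (kadj C) = C := by
  ext x
  simp [kadj, ContinuousLinearMap.adjoint_comp, KreinSpace.adjoint_J, J_J]

theorem kadj_reOp (N : K →L[ℂ] K) : kadj (reOp N) = reOp N := by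
  rw [reOp, kadj_smul, kadj_add, kadj_kadj, add_comm, map_div₀, map_one, map_ofNat]

theorem kadj_imOp (N : K →L[ℂ] K) : kadj (imOp N) = imOp N := by
  rw [imOp, sub_eq_add_neg, ← neg_one_smul ℂ, kadj_smul, kadj_add, kadj_smul, kadj_kadj]
  simp only [map_div₀, map_mul, map_neg, map_one, Complex.conj_I, map_ofNat]
  rw [show (1 : ℂ) / (2 * -Complex.I) = 1 / (2 * Complex.I) * (-1) by
    rw [mul_neg, div_neg, mul_neg_one]]
  module

end KreinAdjoint

section PolynomialCalculus
open scoped IsMulCommutative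
variable {K : Type*} [NormedAddCommGroup K] [InnerProductSpace ℂ K]

theorem commute_evalOp {A B C : K →L[ℂ] K} (hA : Commute C A) (hB : Commute C B) (r : Poly) :
    Commute C (evalOp r A B) :=
  Commute.sum_right _ _ _ fun s _ =>
    (((hA.pow_right (s 0)).mul_right (hB.pow_right (s 1))).smul_right _)

theorem isMulCommutative_adjoin_pair {A B : K →L[ℂ] K} (h : Commute A B) :
    IsMulCommutative (Algebra.adjoin ℂ {A, B}) :=
  Algebra.isMulCommutative_adjoin ℂ (by
    rintro a (rfl | rfl) b (rfl | rfl)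
    exacts [rfl, h.eq, h.eq.symm, rfl])

/-- `r ↦ r(A, B)` for commuting `A`, `B`, as an algebra homomorphism. -/
def evalHom (A B : K →L[ℂ] K) (h : Commute A B) : Poly →ₐ[ℂ] (K →L[ℂ] K) :=
  have := isMulCommutative_adjoin_pair h
  (Subalgebra.val (Algebra.adjoin ℂ {A, B})).comp
    (MvPolynomial.aeval ![⟨A, Algebra.subset_adjoin (by simp)⟩,
      ⟨B, Algebra.subset_adjoin (by simp)⟩])

theorem evalHom_apply (A B : K →L[ℂ] K) (h : Commute A B) (r : Poly) :
    evalHom A B h r = evalOp r A B := by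
  have := isMulCommutative_adjoin_pair h
  show Subalgebra.val (Algebra.adjoin ℂ {A, B}) (MvPolynomial.aeval _ r) = _
  rw [MvPolynomial.aeval_def, MvPolynomial.eval₂_eq', map_sum, evalOp]
  refine Finset.sum_congr rfl fun s _ => ?_
  rw [Fin.prod_univ_two, ← Algebra.smul_def, map_smul, map_mul, map_pow, map_pow]
  rfl

theorem evalHom_X_zero (A B : K →L[ℂ] K) (h : Commute A B) :
    evalHom A B h (MvPolynomial.X 0) = A := by
  simp [evalHom]

theorem evalHom_X_one (A B : K →L[ℂ] K) (h : Commute A B) :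
    evalHom A B h (MvPolynomial.X 1) = B := by
  simp [evalHom]

variable [CompleteSpace K] [KreinSpace K]

theorem commute_reOp_imOp {N : K →L[ℂ] K} (hN : IsKreinNormal N) :
    Commute (reOp N) (imOp N) := by
  have h : Commute N (kadj N) := hN
  exact Commute.smul_left (Commute.smul_right
    (((Commute.refl N).add_left h.symm).sub_right (h.add_left (Commute.refl _))) _) _

theorem commute_reOp {N C : K →L[ℂ] K} (h : Commute C N) (h' : Commute C (kadj N)) :
    Commute C (reOp N) := (h.add_right h').smul_right _

theorem commute_imOp {N C : K →L[ℂ] K} (h : Commute C N) (h' : Commute C (kadj N)) :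
    Commute C (imOp N) := (h.sub_right h').smul_right _

theorem kadj_evalHom {N : K →L[ℂ] K} (h : Commute (reOp N) (imOp N)) (r : Poly) :
    kadj (evalHom _ _ h r) = evalHom _ _ h (sharp r) := by
  induction r using MvPolynomial.induction_on with
  | C a =>
    rw [sharp, MvPolynomial.map_C, ← MvPolynomial.algebraMap_eq, AlgHom.commutes, AlgHom.commutes,
      Algebra.algebraMap_eq_smul_one, Algebra.algebraMap_eq_smul_one, kadj_smul, kadj_one]
  | add r s hr hs => rw [map_add, kadj_add, hr, hs, CalcAlg.sharp_add, map_add]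
  | mul_X r i hr =>
    rw [map_mul, kadj_mul, hr, CalcAlg.sharp_mul, mul_comm, map_mul,
      show sharp (MvPolynomial.X i) = MvPolynomial.X i from MvPolynomial.map_X _ i]
    congr 1
    fin_cases i
    · exact (congrArg kadj (evalHom_X_zero _ _ h)).trans
        ((kadj_reOp N).trans (evalHom_X_zero _ _ h).symm)
    · exact (congrArg kadj (evalHom_X_one _ _ h)).trans
        ((kadj_imOp N).trans (evalHom_X_one _ _ h).symm)

end PolynomialCalculus

section Transport
variable {K : Type*} [NormedAddCommGroup K] [InnerProductSpace ℂ K] [CompleteSpace K] [KreinSpace K]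
variable {E : Type*} [NormedAddCommGroup E] [NormedSpace ℂ E]

theorem embed_factorMap (P : PosOp K) (x : K) : embed P (factorMap P x) = P.op x := by
  have := DFunLike.congr_fun (embed_comp_hkadj P) x
  rwa [hkadj_embed] at this

theorem inner_factorMap_right (P : PosOp K) (h : Hilb P) (y : K) :
    ⟪h, factorMap P y⟫_ℂ = form (embed P h) y := by
  rw [form_hkadj, hkadj_embed]

theorem ext_factorMap (P : PosOp K) {S S' : Hilb P →L[ℂ] E}
    (h : ∀ x, S (factorMap P x) = S' (factorMap P x)) : S = S' :=
  ContinuousLinearMap.coeFn_injective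
    ((denseRange_factorMap P).equalizer S.continuous S'.continuous (funext h))

theorem embed_transport (P : PosOp K) {C : K →L[ℂ] K} (hC : Commute C P.op) (h : Hilb P) :
    embed P (transport P C h) = C (embed P h) :=
  DFunLike.congr_fun (embed_comp_transport P C hC) h

theorem transport_factorMap (P : PosOp K) {C : K →L[ℂ] K} (hC : Commute C P.op) (x : K) :
    transport P C (factorMap P x) = factorMap P (C x) := by
  apply embed_injective P
  rw [embed_transport P hC, embed_factorMap, embed_factorMap]
  exact DFunLike.congr_fun hC.eq x

theorem commute_kadj (P : PosOp K) {C : K →L[ℂ] K} (hC : Commute C P.op) :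
    Commute (kadj C) P.op := kadj_comp_comm P C hC

theorem adjoint_transport (P : PosOp K) {C : K →L[ℂ] K} (hC : Commute C P.op) :
    ContinuousLinearMap.adjoint (transport P C) = transport P (kadj C) := by
  refine ext_factorMap P fun y => ext_inner_left ℂ fun h => ?_
  rw [ContinuousLinearMap.adjoint_inner_right, transport_factorMap P (commute_kadj P hC),
    inner_factorMap_right, inner_factorMap_right, embed_transport P hC, form_kadj]

theorem commute_transport (P : PosOp K) {C C' : K →L[ℂ] K} (hC : Commute C P.op)
    (hC' : Commute C' P.op) (h : Commute C C') : Commute (transport P C) (transport P C') := by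
  refine ext_factorMap P fun y => ?_
  simp only [mul_apply_eq_comp, transport_factorMap P hC, transport_factorMap P hC']
  exact congrArg _ (DFunLike.congr_fun h.eq y)

theorem isStarNormal_transport (P : PosOp K) {N : K →L[ℂ] K} (hN : IsKreinNormal N)
    (hP : Commute N P.op) : IsStarNormal (transport P N) := by
  refine ⟨?_⟩
  rw [ContinuousLinearMap.star_eq_adjoint, adjoint_transport P hP]
  exact commute_transport P (commute_kadj P hP) hP hN.symm

theorem lift_apply (P : PosOp K) (D : Hilb P →L[ℂ] Hilb P) (x : K) :
    lift P D x = embed P (D (factorMap P x)) := by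
  rw [lift, hkadj_embed]; rfl

theorem lift_add (P : PosOp K) (D D' : Hilb P →L[ℂ] Hilb P) :
    lift P (D + D') = lift P D + lift P D' := by
  ext x; simp [lift_apply]

theorem lift_smul (P : PosOp K) (c : ℂ) (D : Hilb P →L[ℂ] Hilb P) :
    lift P (c • D) = c • lift P D := by
  ext x; simp [lift_apply]

theorem kadj_lift (P : PosOp K) (D : Hilb P →L[ℂ] Hilb P) :
    kadj (lift P D) = lift P (ContinuousLinearMap.adjoint D) := by
  ext x
  simp [kadj, lift, hkadj, ContinuousLinearMap.adjoint_comp, KreinSpace.adjoint_J, J_J]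

/-- For `P ≤ Q`, the adjoint of the contraction `Hilb Q → Hilb P` that extends the identity
of `K`. -/
def inclusion (P Q : PosOp K) : Hilb P →L[ℂ] Hilb Q :=
  ContinuousLinearMap.adjoint ((factorMap P : K →ₗ[ℂ] Hilb P).extendOfNorm
    (factorMap Q : K →ₗ[ℂ] Hilb Q))

theorem adjoint_inclusion_factorMap {P Q : PosOp K}
    (h : ∀ x, form (P.op x) x ≤ form (Q.op x) x) (x : K) :
    ContinuousLinearMap.adjoint (inclusion P Q) (factorMap Q x) = factorMap P x := by
  rw [inclusion, ContinuousLinearMap.adjoint_adjoint]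
  refine LinearMap.extendOfNorm_eq (denseRange_factorMap Q) ⟨1, fun x => ?_⟩ x
  rw [one_mul, ← sq_le_sq₀ (norm_nonneg _) (norm_nonneg _),
    InnerProductSpace.norm_sq_eq_re_inner (𝕜 := ℂ), InnerProductSpace.norm_sq_eq_re_inner (𝕜 := ℂ)]
  simp only [ContinuousLinearMap.coe_coe]
  rw [inner_factorMap, inner_factorMap]
  exact (Complex.le_def.1 (h x)).1

theorem embed_inclusion {P Q : PosOp K} (h : ∀ x, form (P.op x) x ≤ form (Q.op x) x)
    (v : Hilb P) : embed Q (inclusion P Q v) = embed P v := by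
  have key : ∀ y, form (embed Q (inclusion P Q v)) y = form (embed P v) y := fun y => by
    rw [← inner_factorMap_right, ← inner_factorMap_right, ← adjoint_inclusion_factorMap h,
      ContinuousLinearMap.adjoint_inner_right]
  have := ext_inner_right ℂ key
  rw [← J_J (embed Q (inclusion P Q v)), this, J_J]

theorem inclusion_injective {P Q : PosOp K} (h : ∀ x, form (P.op x) x ≤ form (Q.op x) x) :
    Function.Injective (inclusion P Q) := fun v w hvw => by
  apply embed_injective P
  rw [← embed_inclusion h, hvw, embed_inclusion h]

theorem inclusion_comp_transport {P Q : PosOp K} (h : ∀ x, form (P.op x) x ≤ form (Q.op x) x)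
    {C : K →L[ℂ] K} (hP : Commute C P.op) (hQ : Commute C Q.op) :
    inclusion P Q ∘L transport P C = transport Q C ∘L inclusion P Q := by
  ext v
  apply embed_injective Q
  simp only [ContinuousLinearMap.comp_apply]
  rw [embed_inclusion h, embed_transport P hP, embed_transport Q hQ, embed_inclusion h]

theorem inclusion_comp_adjoint_transport {P Q : PosOp K}
    (h : ∀ x, form (P.op x) x ≤ form (Q.op x) x) {C : K →L[ℂ] K} (hP : Commute C P.op)
    (hQ : Commute C Q.op) :
    inclusion P Q ∘L ContinuousLinearMap.adjoint (transport P C) =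
      ContinuousLinearMap.adjoint (transport Q C) ∘L inclusion P Q := by
  rw [adjoint_transport P hP, adjoint_transport Q hQ]
  exact inclusion_comp_transport h (commute_kadj P hP) (commute_kadj Q hQ)

end Transport

section TransportCalculus
variable {K : Type*} [NormedAddCommGroup K] [InnerProductSpace ℂ K] [CompleteSpace K] [KreinSpace K]
  {N : K →L[ℂ] K} {P Q : PosOp K} {X : TopologicalSpace.Compacts ℂ}

/-- The polynomial calculus is compatible with `C ↦ T⁻¹ C T`. -/
theorem embed_borelCalc_polyFn (hN : IsKreinNormal N) (hP : Commute N P.op)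
    (hX : spectrum ℂ (transport P N) ⊆ X) (r : Poly) (v : Hilb P) :
    embed P (borelCalc (transport P N) (isStarNormal_transport P hN hP) hX (polyFn X r) v) =
      evalOp r (reOp N) (imOp N) (embed P v) := by
  rw [← evalHom_apply _ _ (commute_reOp_imOp hN)]
  induction r using MvPolynomial.induction_on generalizing v with
  | C a =>
    rw [← MvPolynomial.algebraMap_eq, AlgHom.commutes, AlgHom.commutes, AlgHomClass.commutes,
      Algebra.algebraMap_eq_smul_one, Algebra.algebraMap_eq_smul_one]
    simp
  | add r s hr hs =>
    simp only [map_add, add_apply, hr, hs]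
  | mul_X r i hr =>
    simp only [map_mul, mul_apply_eq_comp, hr]
    congr 1
    fin_cases i
    · show embed P (borelCalc _ _ hX (polyFn X (MvPolynomial.X 0)) v) =
        evalHom _ _ _ (MvPolynomial.X 0) (embed P v)
      rw [borelCalc_X_zero, evalHom_X_zero, adjoint_transport P hP, reOp]
      simp only [smul_apply, add_apply, map_smul, map_add, embed_transport P hP,
        embed_transport P (commute_kadj P hP)]
    · show embed P (borelCalc _ _ hX (polyFn X (MvPolynomial.X 1)) v) =
        evalHom _ _ _ (MvPolynomial.X 1) (embed P v)
      rw [borelCalc_X_one, evalHom_X_one, adjoint_transport P hP, imOp]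
      simp only [smul_apply, sub_apply, map_smul, map_sub, embed_transport P hP,
        embed_transport P (commute_kadj P hP)]

theorem factorMap_evalOp (hN : IsKreinNormal N) (hP : Commute N P.op)
    (hX : spectrum ℂ (transport P N) ⊆ X) (r : Poly) (x : K) :
    factorMap P (evalOp r (reOp N) (imOp N) x) =
      borelCalc (transport P N) (isStarNormal_transport P hN hP) hX (polyFn X r)
        (factorMap P x) := by
  apply embed_injective P
  have h : Commute P.op (evalOp r (reOp N) (imOp N)) :=
    commute_evalOp (commute_reOp hP.symm (commute_kadj P hP).symm)
      (commute_imOp hP.symm (commute_kadj P hP).symm) r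
  rw [embed_borelCalc_polyFn hN hP, embed_factorMap, embed_factorMap]
  exact DFunLike.congr_fun h.eq x

theorem factorMap_embed (hN : IsKreinNormal N) (hP : Commute N P.op)
    (hX : spectrum ℂ (transport P N) ⊆ X) {q : Poly} (hq : P.op = evalOp q (reOp N) (imOp N))
    (v : Hilb P) :
    factorMap P (embed P v) =
      borelCalc (transport P N) (isStarNormal_transport P hN hP) hX (polyFn X q) v := by
  apply embed_injective P
  rw [embed_factorMap, embed_borelCalc_polyFn hN hP, hq]

theorem commute_lift_borelCalc (hN : IsKreinNormal N) (hP : Commute N P.op)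
    (hX : spectrum ℂ (transport P N) ⊆ X) {C : K →L[ℂ] K} (hCP : Commute C P.op)
    (hC : Commute C N) (hC' : Commute C (kadj N)) (f : BddMeas (X : Set ℂ)) :
    Commute C (lift P (borelCalc (transport P N) (isStarNormal_transport P hN hP) hX f)) := by
  have hn := isStarNormal_transport P hN hP
  have h := comp_borelCalc hn hn hX hX (commute_transport P hCP hP hC).eq (by
    rw [adjoint_transport P hP]
    exact (commute_transport P hCP (commute_kadj P hP) hC').eq) f
  ext x
  simp only [mul_apply_eq_comp, lift_apply]
  rw [← embed_transport P hCP, ← transport_factorMap P hCP]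
  exact congrArg (embed P) (DFunLike.congr_fun h _)

theorem inclusion_borelCalc (hN : IsKreinNormal N) (hP : Commute N P.op) (hQ : Commute N Q.op)
    (h : ∀ x, form (P.op x) x ≤ form (Q.op x) x) (hX : spectrum ℂ (transport P N) ⊆ X)
    (hX' : spectrum ℂ (transport Q N) ⊆ X) (f : BddMeas (X : Set ℂ)) (v : Hilb P) :
    inclusion P Q (borelCalc (transport P N) (isStarNormal_transport P hN hP) hX f v) =
      borelCalc (transport Q N) (isStarNormal_transport Q hN hQ) hX' f (inclusion P Q v) :=
  DFunLike.congr_fun (comp_borelCalc (isStarNormal_transport P hN hP)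
    (isStarNormal_transport Q hN hQ) hX hX' (inclusion_comp_transport h hP hQ)
    (inclusion_comp_adjoint_transport h hP hQ) f) v

theorem adjoint_inclusion_borelCalc (hN : IsKreinNormal N) (hP : Commute N P.op)
    (hQ : Commute N Q.op)
    (h : ∀ x, form (P.op x) x ≤ form (Q.op x) x) (hX : spectrum ℂ (transport P N) ⊆ X)
    (hX' : spectrum ℂ (transport Q N) ⊆ X) (f : BddMeas (X : Set ℂ)) (w : Hilb Q) :
    ContinuousLinearMap.adjoint (inclusion P Q)
        (borelCalc (transport Q N) (isStarNormal_transport Q hN hQ) hX' f w) =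
      borelCalc (transport P N) (isStarNormal_transport P hN hP) hX f
        (ContinuousLinearMap.adjoint (inclusion P Q) w) := by
  refine ext_inner_left ℂ fun v => ?_
  rw [ContinuousLinearMap.adjoint_inner_right, inner_borelCalc,
    ← inclusion_borelCalc hN hP hQ h hX hX', inner_borelCalc,
    ContinuousLinearMap.adjoint_inner_right]

/-- If `P = q(A, B) ≤ Q = q'(A, B)` and `R : Hilb P → Hilb Q` is the inclusion, then
`q(Θ(N)) = R R* q'(Θ(N))` on `Hilb Q`. -/
theorem inclusion_adjoint_inclusion_borelCalc (hN : IsKreinNormal N) (hQ : Commute N Q.op)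
    (h : ∀ x, form (P.op x) x ≤ form (Q.op x) x)
    (hX' : spectrum ℂ (transport Q N) ⊆ X) {q q' : Poly}
    (hq : P.op = evalOp q (reOp N) (imOp N)) (hq' : Q.op = evalOp q' (reOp N) (imOp N))
    (w : Hilb Q) :
    inclusion P Q (ContinuousLinearMap.adjoint (inclusion P Q)
        (borelCalc (transport Q N) (isStarNormal_transport Q hN hQ) hX' (polyFn X q') w)) =
      borelCalc (transport Q N) (isStarNormal_transport Q hN hQ) hX' (polyFn X q) w := by
  apply embed_injective Q
  rw [embed_inclusion h, ← factorMap_embed hN hQ hX' hq', adjoint_inclusion_factorMap h,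
    embed_factorMap, embed_borelCalc_polyFn hN hQ, hq]

end TransportCalculus

section Main
variable {K : Type*} [NormedAddCommGroup K] [InnerProductSpace ℂ K] [CompleteSpace K] [KreinSpace K]
  {N : K →L[ℂ] K} {m : ℕ} {p : Fin m → MvPolynomial (Fin 2) ℝ}

theorem commute_posOp {C : K →L[ℂ] K} (hp : ∀ j, IsDefinitizing N (p j)) (hC : Commute C N)
    (hC' : Commute C (kadj N)) (k : Fin m) : Commute C (posOp N p hp k).op :=
  commute_evalOp (commute_reOp hC hC') (commute_imOp hC hC') _

theorem commute_posOpSum (hN : IsKreinNormal N) (hp : ∀ j, IsDefinitizing N (p j)) :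
    Commute N (posOpSum N p hp).op :=
  Commute.sum_right _ _ _ fun k _ => commute_posOp hp (Commute.refl N) hN k

theorem posOpSum_op (hN : IsKreinNormal N) (hp : ∀ j, IsDefinitizing N (p j)) :
    (posOpSum N p hp).op = evalOp (∑ k, complexify (p k)) (reOp N) (imOp N) := by
  rw [← evalHom_apply _ _ (commute_reOp_imOp hN), map_sum]
  simp only [evalHom_apply]
  rfl

theorem form_posOp_le (hp : ∀ j, IsDefinitizing N (p j)) (k : Fin m) (x : K) :
    form ((posOp N p hp k).op x) x ≤ form ((posOpSum N p hp).op x) x := by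
  have : form ((posOpSum N p hp).op x) x = ∑ j, form ((posOp N p hp j).op x) x := by
    simp only [posOpSum, posOp, form, sum_apply, map_sum, sum_inner]
  rw [this]
  exact Finset.single_le_sum (f := fun j => form ((posOp N p hp j).op x) x)
    (fun j _ => (posOp N p hp j).nonneg x) (Finset.mem_univ k)

theorem isStarNormal_transport_posOp (hN : IsKreinNormal N) (hp : ∀ j, IsDefinitizing N (p j))
    (k : Fin m) : IsStarNormal (transport (posOp N p hp k) N) :=
  isStarNormal_transport _ hN (commute_posOp hp (Commute.refl N) hN k)

theorem isStarNormal_transport_posOpSum (hN : IsKreinNormal N)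
    (hp : ∀ j, IsDefinitizing N (p j)) : IsStarNormal (transport (posOpSum N p hp) N) :=
  isStarNormal_transport _ hN (commute_posOpSum hN hp)

/-- `σ(Θ_k(N)) ⊆ σ(Θ(N))`. -/
theorem spectrum_transport_posOp_subset (hN : IsKreinNormal N)
    (hp : ∀ j, IsDefinitizing N (p j)) (k : Fin m) :
    spectrum ℂ (transport (posOp N p hp k) N) ⊆ spec N p hp :=
  spectrum_subset_of_intertwine (isStarNormal_transport_posOp hN hp k)
    (isStarNormal_transport_posOpSum hN hp) (inclusion_injective (form_posOp_le hp k))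
    (inclusion_comp_transport (form_posOp_le hp k) (commute_posOp hp (Commute.refl N) hN k)
      (commute_posOpSum hN hp))
    (inclusion_comp_adjoint_transport (form_posOp_le hp k)
      (commute_posOp hp (Commute.refl N) hN k) (commute_posOpSum hN hp))

/-- The functional calculus of `Θ_k(N)`, for functions on `σ(Θ(N))`. -/
def calcPart (hN : IsKreinNormal N) (hp : ∀ j, IsDefinitizing N (p j)) (k : Fin m) :
    BddMeas (spec N p hp : Set ℂ) →⋆ₐ[ℂ] (Hilb (posOp N p hp k) →L[ℂ] Hilb (posOp N p hp k)) :=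
  borelCalc (transport (posOp N p hp k) N) (isStarNormal_transport_posOp hN hp k)
    (spectrum_transport_posOp_subset hN hp k)

/-- The functional calculus of `Θ(N)`. -/
def calcSum (hN : IsKreinNormal N) (hp : ∀ j, IsDefinitizing N (p j)) :
    BddMeas (spec N p hp : Set ℂ) →⋆ₐ[ℂ] (Hilb (posOpSum N p hp) →L[ℂ] Hilb (posOpSum N p hp)) :=
  borelCalc (transport (posOpSum N p hp) N) (isStarNormal_transport_posOpSum hN hp) subset_rfl

/-- `f ↦ Ξ_k(∫ f dE_k)`. -/
def liftCalc (hN : IsKreinNormal N) (hp : ∀ j, IsDefinitizing N (p j)) (k : Fin m)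
    (f : BddMeas (spec N p hp : Set ℂ)) : K →L[ℂ] K :=
  lift (posOp N p hp k) (calcPart hN hp k f)

variable (hN : IsKreinNormal N) (hp : ∀ j, IsDefinitizing N (p j))
include hN

theorem Psi_eq (a : CalcAlg (spec N p hp) p) :
    Psi N p hp a = evalHom _ _ (commute_reOp_imOp hN) a.poly + ∑ k, liftCalc hN hp k (a.fn k) := by
  rw [evalHom_apply]; rfl

theorem liftCalc_add (k : Fin m) (f g : BddMeas (spec N p hp : Set ℂ)) :
    liftCalc hN hp k (f + g) = liftCalc hN hp k f + liftCalc hN hp k g := by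
  rw [liftCalc, map_add, lift_add]; rfl

theorem liftCalc_smul (k : Fin m) (c : ℂ) (f : BddMeas (spec N p hp : Set ℂ)) :
    liftCalc hN hp k (c • f) = c • liftCalc hN hp k f := by
  rw [liftCalc, map_smul, lift_smul]; rfl

theorem liftCalc_sum {ι : Type*} (s : Finset ι) (k : Fin m)
    (f : ι → BddMeas (spec N p hp : Set ℂ)) :
    liftCalc hN hp k (∑ i ∈ s, f i) = ∑ i ∈ s, liftCalc hN hp k (f i) := by
  classical
  induction s using Finset.induction_on with
  | empty => simpa using liftCalc_smul hN hp k 0 0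
  | insert a s ha ih => rw [Finset.sum_insert ha, Finset.sum_insert ha, liftCalc_add, ih]

theorem kadj_liftCalc (k : Fin m) (f : BddMeas (spec N p hp : Set ℂ)) :
    kadj (liftCalc hN hp k f) = liftCalc hN hp k (star f) := by
  rw [liftCalc, kadj_lift, liftCalc, map_star, ContinuousLinearMap.star_eq_adjoint]

theorem evalOp_mul_liftCalc (r : Poly) (k : Fin m) (f : BddMeas (spec N p hp : Set ℂ)) :
    evalOp r (reOp N) (imOp N) * liftCalc hN hp k f =
      liftCalc hN hp k (polyFn (spec N p hp) r * f) := by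
  ext x
  simp only [mul_apply_eq_comp, liftCalc, lift_apply, map_mul]
  exact (embed_borelCalc_polyFn hN (commute_posOp hp (Commute.refl N) hN k)
    (spectrum_transport_posOp_subset hN hp k) r _).symm

theorem liftCalc_mul_evalOp (r : Poly) (k : Fin m) (f : BddMeas (spec N p hp : Set ℂ)) :
    liftCalc hN hp k f * evalOp r (reOp N) (imOp N) =
      liftCalc hN hp k (polyFn (spec N p hp) r * f) := by
  ext x
  simp only [mul_apply_eq_comp, liftCalc, lift_apply, mul_comm _ f, map_mul]
  exact congrArg (fun v => embed (posOp N p hp k) (calcPart hN hp k f v))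
    (factorMap_evalOp hN (commute_posOp hp (Commute.refl N) hN k)
      (spectrum_transport_posOp_subset hN hp k) r x)

theorem liftCalc_polyFn (r : Poly) (k : Fin m) :
    liftCalc hN hp k (polyFn (spec N p hp) r) =
      evalOp r (reOp N) (imOp N) * evalOp (complexify (p k)) (reOp N) (imOp N) := by
  ext x
  rw [liftCalc, lift_apply]
  refine (embed_borelCalc_polyFn hN (commute_posOp hp (Commute.refl N) hN k)
    (spectrum_transport_posOp_subset hN hp k) r _).trans ?_
  rw [embed_factorMap]; rfl

theorem inclusion_calcPart (k : Fin m) (f : BddMeas (spec N p hp : Set ℂ))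
    (v : Hilb (posOp N p hp k)) :
    inclusion (posOp N p hp k) (posOpSum N p hp) (calcPart hN hp k f v) =
      calcSum hN hp f (inclusion (posOp N p hp k) (posOpSum N p hp) v) :=
  inclusion_borelCalc hN (commute_posOp hp (Commute.refl N) hN k) (commute_posOpSum hN hp)
    (form_posOp_le hp k) (spectrum_transport_posOp_subset hN hp k) subset_rfl f v

theorem adjoint_inclusion_calcSum (k : Fin m) (f : BddMeas (spec N p hp : Set ℂ))
    (w : Hilb (posOpSum N p hp)) :
    ContinuousLinearMap.adjoint (inclusion (posOp N p hp k) (posOpSum N p hp))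
        (calcSum hN hp f w) =
      calcPart hN hp k f
        (ContinuousLinearMap.adjoint (inclusion (posOp N p hp k) (posOpSum N p hp)) w) :=
  adjoint_inclusion_borelCalc hN (commute_posOp hp (Commute.refl N) hN k)
    (commute_posOpSum hN hp) (form_posOp_le hp k) (spectrum_transport_posOp_subset hN hp k)
    subset_rfl f w

/-- The operator `R_k R_k*` on `Hilb (∑ p_j(A, B))`, where `T R_k = T_k`. -/
def density (hp : ∀ j, IsDefinitizing N (p j)) (k : Fin m) :
    Hilb (posOpSum N p hp) →L[ℂ] Hilb (posOpSum N p hp) :=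
  inclusion (posOp N p hp k) (posOpSum N p hp) ∘L
    ContinuousLinearMap.adjoint (inclusion (posOp N p hp k) (posOpSum N p hp))

theorem density_calcSum_comm (k : Fin m) (f : BddMeas (spec N p hp : Set ℂ)) :
    density hp k * calcSum hN hp f = calcSum hN hp f * density hp k := by
  ext w
  simp only [mul_apply_eq_comp, density, ContinuousLinearMap.comp_apply]
  rw [adjoint_inclusion_calcSum, inclusion_calcPart]

theorem density_mul_calcSum_polyFn (k : Fin m) :
    density hp k * calcSum hN hp (polyFn (spec N p hp) (∑ j, complexify (p j))) =
      calcSum hN hp (polyFn (spec N p hp) (complexify (p k))) := by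
  ext w
  exact inclusion_adjoint_inclusion_borelCalc hN (commute_posOpSum hN hp) (form_posOp_le hp k)
    subset_rfl rfl (posOpSum_op hN hp) w

/-- `Ξ_k(∫ f dE_k) = T R_k R_k* (∫ f dE) T⁺`. -/
theorem liftCalc_apply (k : Fin m) (f : BddMeas (spec N p hp : Set ℂ)) (x : K) :
    liftCalc hN hp k f x =
      embed (posOpSum N p hp) (density hp k (calcSum hN hp f (factorMap (posOpSum N p hp) x))) := by
  rw [liftCalc, lift_apply, density, ContinuousLinearMap.comp_apply, adjoint_inclusion_calcSum,
    embed_inclusion (form_posOp_le hp k), adjoint_inclusion_factorMap (form_posOp_le hp k)]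

theorem liftCalc_mul_liftCalc (k l : Fin m) (f g : BddMeas (spec N p hp : Set ℂ)) :
    liftCalc hN hp k f * liftCalc hN hp l g =
      liftCalc hN hp k (f * (g * polyFn (spec N p hp) (complexify (p l)))) := by
  ext x
  have h1 : ∀ w, factorMap (posOpSum N p hp) (embed (posOpSum N p hp) w) =
      calcSum hN hp (polyFn (spec N p hp) (∑ j, complexify (p j))) w :=
    factorMap_embed hN (commute_posOpSum hN hp) subset_rfl (posOpSum_op hN hp)
  have h2 : calcSum hN hp (polyFn (spec N p hp) (∑ j, complexify (p j))) *
      (density hp l * calcSum hN hp g) =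
      calcSum hN hp (g * polyFn (spec N p hp) (complexify (p l))) := by
    rw [← mul_assoc, ← density_calcSum_comm, density_mul_calcSum_polyFn, ← map_mul, mul_comm]
  rw [mul_apply_eq_comp, liftCalc_apply, liftCalc_apply, liftCalc_apply, h1, map_mul, ← h2]
  rfl

theorem sum_liftCalc_mul_sum_liftCalc (f g : Fin m → BddMeas (spec N p hp : Set ℂ)) :
    (∑ k, liftCalc hN hp k (f k)) * ∑ l, liftCalc hN hp l (g l) =
      ∑ k, liftCalc hN hp k (f k * CalcAlg.wsum p g) := by
  rw [Finset.sum_mul]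
  refine Finset.sum_congr rfl fun k _ => ?_
  rw [Finset.mul_sum, CalcAlg.wsum, Finset.mul_sum, liftCalc_sum]
  exact Finset.sum_congr rfl fun l _ => liftCalc_mul_liftCalc hN hp k l (f k) (g l)

theorem Psi_one : Psi N p hp 1 = 1 := by
  rw [Psi_eq hN, CalcAlg.one_poly, map_one]
  have : ∀ k, liftCalc hN hp k ((1 : CalcAlg (spec N p hp) p).fn k) = 0 := fun k => by
    simpa using liftCalc_smul hN hp k 0 0
  simp only [this, Finset.sum_const_zero, add_zero]

theorem Psi_add (a b : CalcAlg (spec N p hp) p) :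
    Psi N p hp (a + b) = Psi N p hp a + Psi N p hp b := by
  simp only [Psi_eq hN, CalcAlg.add_poly, CalcAlg.add_fn, Pi.add_apply, map_add,
    liftCalc_add hN hp, Finset.sum_add_distrib]
  abel

theorem Psi_smul (c : ℂ) (a : CalcAlg (spec N p hp) p) :
    Psi N p hp (c • a) = c • Psi N p hp a := by
  simp only [Psi_eq hN, CalcAlg.smul_poly, CalcAlg.smul_fn, Pi.smul_apply, map_smul,
    liftCalc_smul hN hp, smul_add, Finset.smul_sum]

theorem Psi_mul (a b : CalcAlg (spec N p hp) p) :
    Psi N p hp (a * b) = Psi N p hp a * Psi N p hp b := by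
  simp only [Psi_eq hN, CalcAlg.mul_poly, CalcAlg.mul_fn, map_mul, liftCalc_add hN hp,
    Finset.sum_add_distrib]
  rw [mul_add, add_mul, add_mul, sum_liftCalc_mul_sum_liftCalc, Finset.mul_sum, Finset.sum_mul]
  simp only [evalHom_apply, evalOp_mul_liftCalc hN hp, liftCalc_mul_evalOp hN hp]
  abel

theorem Psi_star (a : CalcAlg (spec N p hp) p) :
    Psi N p hp (star a) = kadj (Psi N p hp a) := by
  simp only [Psi_eq hN, kadj_add, kadj_sum, kadj_evalHom, kadj_liftCalc hN hp]
  rfl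

/-- If `∑ g_k p_k = 0` and the `g_k` vanish on the common zeros of the `p_k`, then
`∑ R_k R_k* ∫ g_k dE = 0`. -/
theorem sum_density_mul_calcSum_eq_zero (g : Fin m → BddMeas (spec N p hp : Set ℂ))
    (h : CalcAlg.wsum p g = 0)
    (h0 : ∀ k, ∀ z : (spec N p hp : Set ℂ), (z : ℂ) ∈ CalcAlg.realZeros p → (g k).1 z = 0) :
    ∑ k, density hp k * calcSum hN hp (g k) = 0 := by
  set S := ∑ k, density hp k * calcSum hN hp (g k) with hS
  set q := polyFn (spec N p hp) (∑ j, complexify (p j)) with hq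
  have h1 : S * calcSum hN hp q = 0 := by
    rw [hS, Finset.sum_mul]
    have : ∀ k, density hp k * calcSum hN hp (g k) * calcSum hN hp q =
        calcSum hN hp (g k * polyFn (spec N p hp) (complexify (p k))) := fun k => by
      rw [mul_assoc, ← map_mul, mul_comm (g k), map_mul, ← mul_assoc, hq,
        density_mul_calcSum_polyFn, ← map_mul, mul_comm]
    simp only [this]
    rw [← map_sum]
    exact (congrArg _ h).trans (map_zero _)
  have hqs : star q = q := by
    rw [hq, ← CalcAlg.polyFn_sharp, sharp, map_sum]
    exact congrArg _ (Finset.sum_congr rfl fun k _ => CalcAlg.sharp_complexify _)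
  have h1' : calcSum hN hp q * star S = 0 := by
    rw [← hqs, map_star, ← star_mul, h1, star_zero]
  have h2 : ∀ x, calcSum hN hp q x = 0 → S x = 0 := fun x hx => by
    have h3 : ∀ k, calcSum hN hp (polyFn (spec N p hp) (complexify (p k))) x = 0 := fun k => by
      rw [← density_mul_calcSum_polyFn, mul_apply_eq_comp, ← hq, hx, map_zero]
    rw [hS, sum_apply]
    refine Finset.sum_eq_zero fun k _ => ?_
    rw [mul_apply_eq_comp, calcSum, borelCalc_apply_eq_zero
      (isStarNormal_transport_posOpSum hN hp) subset_rfl _ (g k) h3 fun z hz => h0 k z hz, map_zero]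
  refine (CStarRing.mul_star_self_eq_zero_iff S).1 (ContinuousLinearMap.ext fun x => ?_)
  exact h2 _ (DFunLike.congr_fun h1' x)

theorem Psi_eq_zero_of_memNull {a : CalcAlg (spec N p hp) p} (ha : a.MemNull) :
    Psi N p hp a = 0 := by
  rw [CalcAlg.memNull_iff] at ha
  obtain ⟨h1, u, hu, h2⟩ := ha
  set g : Fin m → BddMeas (spec N p hp : Set ℂ) :=
    a.fn + fun k => polyFn (spec N p hp) (u k) with hg
  have hw : CalcAlg.wsum p g = 0 := by
    have e : CalcAlg.wsum p g = polyFn (spec N p hp) a.poly + CalcAlg.wsum p a.fn := by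
      rw [hg, CalcAlg.wsum_add, add_comm, hu, map_sum]
      simp only [map_mul]
      rfl
    refine Subtype.ext (funext fun z => ?_)
    by_cases hz : (z : ℂ) ∈ CalcAlg.realZeros p
    · exact CalcAlg.wsum_val_eq_zero g z hz
    · rw [e]; exact h1 z hz
  have hsum : Psi N p hp a = ∑ k, liftCalc hN hp k (g k) := by
    simp only [Psi_eq hN, hg, Pi.add_apply, liftCalc_add hN hp, Finset.sum_add_distrib,
      liftCalc_polyFn hN hp]
    rw [add_comm, hu, map_sum]
    simp only [map_mul, evalHom_apply]
  have h0 := sum_density_mul_calcSum_eq_zero hN hp g hw h2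
  ext x
  have hx := DFunLike.congr_fun h0 (factorMap (posOpSum N p hp) x)
  simp only [sum_apply, mul_apply_eq_comp] at hx
  rw [hsum, sum_apply]
  simp only [liftCalc_apply]
  rw [← map_sum, hx]
  simp

theorem Psi_mem_bicommutant (a : CalcAlg (spec N p hp) p) :
    Psi N p hp a ∈ Set.centralizer (Set.centralizer {N, kadj N}) := by
  intro C hC
  have h1 : Commute C N := (hC N (by simp)).symm
  have h2 : Commute C (kadj N) := (hC (kadj N) (by simp)).symm
  refine Commute.eq (Commute.add_right
    (commute_evalOp (commute_reOp h1 h2) (commute_imOp h1 h2) _)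
    (Commute.sum_right _ _ _ fun k _ => ?_))
  exact commute_lift_borelCalc hN (commute_posOp hp (Commute.refl N) hN k)
    (spectrum_transport_posOp_subset hN hp k) (commute_posOp hp h1 h2 k) h1 h2 (a.fn k)

/-- `Ψ` as a homomorphism of `ℂ`-algebras. -/
def PsiHom : CalcAlg (spec N p hp) p →ₐ[ℂ] (K →L[ℂ] K) where
  toFun := Psi N p hp
  map_one' := Psi_one hN hp
  map_mul' := Psi_mul hN hp
  map_zero' := by simpa using Psi_smul hN hp 0 0
  map_add' := Psi_add hN hp
  commutes' c := by
    rw [Algebra.algebraMap_eq_smul_one, Psi_smul hN hp, Psi_one hN hp,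
      Algebra.algebraMap_eq_smul_one]

end Main

end KreinCalculus
end

theorem mainTheorem2 {K : Type*} [NormedAddCommGroup K] [InnerProductSpace ℂ K] [CompleteSpace K]
    [KreinSpace K] (N : K →L[ℂ] K) (hN : IsKreinNormal N) {m : ℕ}
    (p : Fin m → MvPolynomial (Fin 2) ℝ) (hp : ∀ j, IsDefinitizing N (p j)) :
    ∃ Φ : QuotAlg (spec N p hp) p →ₐ[ℂ] (K →L[ℂ] K),
      (∀ a : CalcAlg (spec N p hp) p,
        Φ (Ideal.Quotient.mk (nullIdeal (spec N p hp) p) a) = Psi N p hp a) ∧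
      (∀ q, Φ (star q) = kadj (Φ q)) ∧
      ∀ q, Φ q ∈ Set.centralizer (Set.centralizer {N, kadj N}) := by
  refine ⟨Ideal.Quotient.liftₐ (nullIdeal (spec N p hp) p) (PsiHom hN hp)
    fun a ha => Psi_eq_zero_of_memNull hN hp ha, fun a => rfl, fun q => ?_, fun q => ?_⟩
  · obtain ⟨a, rfl⟩ := Ideal.Quotient.mk_surjective q
    exact Psi_star hN hp a
  · obtain ⟨a, rfl⟩ := Ideal.Quotient.mk_surjective q
    exact Psi_mem_bicommutant hN hp a
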